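/- Let $q$ be a prime power, let $m\ge 2$, and let $K=\mathbb{F}_{q^m}$, $F=\mathbb{F}_q$. For a cyclic Galois extension $L/F$ of degree $n$, a generator $\sigma$ of $\mathrm{Gal}(L/F)$, an integer $d\ge 2$ and $a\in L$, let $L[t;\sigma]$ be the twisted polynomial ring (with $tx=\sigma(x)t$ for $x\in L$) and let $L[t;\sigma]/L[t;\sigma](t^d-a)$ denote the unital nonassociative $F$-algebra consisting of the twisted polynomials of degree less than $d$, where the product of $g$ and $h$ is the remainder $r$ of $gh$ after right division by $t^d-a$, i.e. $gh=s\,(t^d-a)+r$ with $\deg r<d$. For $d=n$ this algebra is denoted by $(L/F,\sigma,a)$. A semifield over $F$ is a finite-dimensional unital nonassociative division algebra over the finite field $F$ (a nonzero algebra in which left and right multiplication by every nonzero element are bijective). A Sandler semifield over $F$ is a semifield that is isomorphic to the opposite algebra of some $L[t;\sigma]/L[t;\sigma](t^d-a)$ with $n\ge d\ge 2$. All isomorphisms are isomorphisms of $F$-algebras. (i) $\mathrm{Gal}(K/F)$ has $\varphi(m)$ generators, where $\varphi$ is the Euler function. For each generator $\sigma$ there is some $a\in K$ such that $(K/F,\sigma,a)$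 is a semifield, and if $\sigma_1\neq\sigma_2$ are distinct generators and $(K/F,\sigma_1,a_1)$ and $(K/F,\sigma_2,a_2)$ are semifields, with $a_1,a_2\in K$, then they are not isomorphic. Thus there are $\varphi(m)$ different classes of non-isomorphic semifields $(K/F,\sigma,a)$, one for each choice of generator $\sigma$ of $\mathrm{Gal}(K/F)$. (ii) If $m$ is prime and $m\nmid q-1$, then there are, up to isomorphism, exactly $$\frac{(m-1)(q^m-q)}{m(q-1)}$$ Sandler semifields over $F$ of order $q^{m^2}$ with center $\mathbb{F}_q$ and with left, middle and right nucleus isomorphic to $\mathbb{F}_{q^m}$. (iii) If $m$ is prime and $m\mid q-1$, then there are, up to isomorphism, exactly $$(m-1)\left((m-1)+\frac{q^m-q-(q-1)(m-1)}{m(q-1)}\right)$$ Sandler semifields over $F$ of order $q^{m^2}$ with center $\mathbb{F}_q$ and with left, middle and right nucleus isomorphic to $\mathbb{F}_{q^m}$. -/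

import Mathlib

universe u

noncomputable section

namespace Petit

open SkewPolynomial

/-! ### Twisted polynomial rings -/

section Twisted

variable {F K : Type u} [Field F] [Field K] [Algebra F K]

/-- The field `K` itself, remembering an automorphism `σ`. It carries the action of
`Multiplicative ℕ` by powers of `σ` that Mathlib's skew polynomials are built on. -/
def Twist (_σ : K ≃ₐ[F] K) : Type u := K

variable (σ : K ≃ₐ[F] K)

instance : Field (Twist σ) := inferInstanceAs (Field K)

instance : Algebra F (Twist σ) := inferInstanceAs (Algebra F K)

/-- The identity map from `K` to its twisted copy. -/
def toTwist : K ≃ₐ[F] Twist σ := AlgEquiv.refl (R := F) (A₁ := K)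

instance : MulSemiringAction (Multiplicative ℕ) (Twist σ) where
  smul n x := toTwist σ ((σ ^ n.toAdd) ((toTwist σ).symm x))
  one_smul _ := rfl
  mul_smul a b x := by
    change toTwist σ ((σ ^ (a.toAdd + b.toAdd)) ((toTwist σ).symm x)) = _
    rw [pow_add]
    rfl
  smul_zero n := map_zero (σ ^ n.toAdd)
  smul_add n x y := map_add (σ ^ n.toAdd) ((toTwist σ).symm x) ((toTwist σ).symm y)
  smul_one n := map_one (σ ^ n.toAdd)
  smul_mul n x y := map_mul (σ ^ n.toAdd) ((toTwist σ).symm x) ((toTwist σ).symm y)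

/-- The twisted polynomial ring `K[t;σ]`, in which `t x = σ(x) t` for `x ∈ K`. -/
abbrev TwistedPolynomial : Type u := SkewPolynomial (Twist σ)

theorem twist_smul (n : ℕ) (x : K) :
    (Multiplicative.ofAdd n) • toTwist σ x = toTwist σ ((σ ^ n) x) := rfl

theorem X_mul_C (x : K) :
    (X : TwistedPolynomial σ) * C (toTwist σ x) = C (toTwist σ (σ x)) * X := by
  rw [C_mul_X_eq_monomial, ← monomial_one_one_eq_X, monomial_mul_C, one_mul, φ_iterate_apply,
    twist_smul, pow_one]

theorem smul_eq_C_mul (c : F) (p : TwistedPolynomial σ) :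
    c • p = C (algebraMap F (Twist σ) c) * p := by
  induction p using SkewPolynomial.induction with
  | h0 => simp
  | ha n r q _ _ ih =>
    rw [smul_add, mul_add, ih, C_mul_monomial, smul_monomial, Algebra.smul_def]

theorem C_algebraMap_mul_comm (c : F) (p : TwistedPolynomial σ) :
    p * C (algebraMap F (Twist σ) c) = C (algebraMap F (Twist σ) c) * p := by
  induction p using SkewPolynomial.induction with
  | h0 => simp
  | ha n r q _ _ ih =>
    have h : φ^[n] (algebraMap F (Twist σ) c) = algebraMap F (Twist σ) c := by
      rw [φ_iterate_apply]
      exact (σ ^ n).commutes c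
    rw [add_mul, mul_add, ih, C_mul_monomial, monomial_mul_C, h, mul_comm]

/-- The binomial `t^m - a` in `K[t;σ]`. -/
def binomial (m : ℕ) (a : K) : TwistedPolynomial σ := X ^ m - C (toTwist σ a)

/-- The `F`-space `R_m` of twisted polynomials of degree less than `m`. -/
def degreeLT (m : ℕ) : Submodule F (TwistedPolynomial σ) where
  carrier := {g | ∀ i, m ≤ i → g.coeff i = 0}
  zero_mem' _ _ := rfl
  add_mem' {p q} hp hq i hi := by rw [coeff_add, hp i hi, hq i hi, add_zero]
  smul_mem' c p hp i hi := by
    change c • p.coeff i = 0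
    rw [hp i hi, smul_zero]

theorem mem_degreeLT {m : ℕ} {g : TwistedPolynomial σ} :
    g ∈ degreeLT σ m ↔ ∀ i, m ≤ i → g.coeff i = 0 := Iff.rfl

/-- `r` is a remainder of the right division of `g` by `f = t^m - a`:
`deg r < m` and `g = s f + r` for some `s`. -/
def IsRemainder (m : ℕ) (a : K) (g : TwistedPolynomial σ) (r : degreeLT σ m) : Prop :=
  ∃ s : TwistedPolynomial σ, g = s * binomial σ m a + r

variable {σ}

theorem IsRemainder.add {m : ℕ} {a : K} {g h : TwistedPolynomial σ} {r r' : degreeLT σ m}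
    (hg : IsRemainder σ m a g r) (hh : IsRemainder σ m a h r') :
    IsRemainder σ m a (g + h) (r + r') := by
  obtain ⟨s, rfl⟩ := hg
  obtain ⟨s', rfl⟩ := hh
  exact ⟨s + s', by rw [add_mul, Submodule.coe_add]; abel⟩

theorem IsRemainder.smul {m : ℕ} {a : K} {g : TwistedPolynomial σ} {r : degreeLT σ m}
    (c : F) (hg : IsRemainder σ m a g r) : IsRemainder σ m a (c • g) (c • r) := by
  obtain ⟨s, rfl⟩ := hg
  refine ⟨c • s, ?_⟩
  rw [smul_add, smul_eq_C_mul σ c (s * _), smul_eq_C_mul σ c s, mul_assoc, Submodule.coe_smul]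

theorem exists_isRemainder_monomial {m : ℕ} (hm : 0 < m) (a : K) (n : ℕ) :
    ∀ x : Twist σ, ∃ r, IsRemainder σ m a (monomial n x) r := by
  induction n using Nat.strong_induction_on with
  | _ n ih =>
    intro x
    by_cases hn : n < m
    · refine ⟨⟨monomial n x, fun i hi => ?_⟩, 0, by simp⟩
      rw [coeff_monomial, if_neg (by omega)]
    · obtain ⟨r, s, hs⟩ := ih (n - m) (by omega) (x * φ^[n - m] (toTwist σ a))
      refine ⟨r, s + monomial (n - m) x, ?_⟩
      have h : monomial (n - m) x * binomial σ m a =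
          monomial n x - monomial (n - m) (x * φ^[n - m] (toTwist σ a)) := by
        rw [binomial, mul_sub, monomial_mul_X_pow, monomial_mul_C, Nat.sub_add_cancel (by omega)]
      rw [add_mul, h, hs]
      abel

theorem exists_isRemainder {m : ℕ} (hm : 0 < m) (a : K) (g : TwistedPolynomial σ) :
    ∃ r, IsRemainder σ m a g r := by
  induction g using SkewPolynomial.induction with
  | h0 => exact ⟨0, 0, by simp⟩
  | ha n x q _ _ ih =>
    obtain ⟨r, hr⟩ := ih
    obtain ⟨r', hr'⟩ := exists_isRemainder_monomial hm a n x
    exact ⟨_, hr'.add hr⟩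

theorem coeff_mul_X_pow (p : TwistedPolynomial σ) (m d : ℕ) :
    (p * X ^ m).coeff (d + m) = p.coeff d := by
  induction p using SkewPolynomial.induction with
  | h0 => simp
  | ha n x q _ _ ih =>
    rw [add_mul, coeff_add, coeff_add, ih, monomial_mul_X_pow, coeff_monomial, coeff_monomial]
    simp

theorem coeff_mul_C (p : TwistedPolynomial σ) (y : Twist σ) (d : ℕ) :
    (p * C y).coeff d = p.coeff d * φ^[d] y := by
  induction p using SkewPolynomial.induction with
  | h0 => simp
  | ha n x q _ _ ih =>
    rw [add_mul, coeff_add, coeff_add, ih, monomial_mul_C, coeff_monomial, coeff_monomial, add_mul]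
    split_ifs with h
    · rw [h]
    · simp

theorem eq_zero_of_mul_binomial_mem {m : ℕ} (hm : 0 < m) (a : K) (s : TwistedPolynomial σ)
    (h : s * binomial σ m a ∈ degreeLT σ m) : s = 0 := by
  by_contra hs
  have hne : s.support.Nonempty := by
    rw [Finset.nonempty_iff_ne_empty, Ne, support_eq_empty]
    exact hs
  obtain ⟨d, hd, hmax⟩ := Finset.exists_max_image s.support id hne
  have h1 := h (d + m) (by omega)
  have h2 : s.coeff (d + m) = 0 := by
    by_contra hc
    have := hmax (d + m) (mem_support_iff.2 hc)
    simp only [id] at this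
    omega
  rw [binomial, mul_sub, coeff_sub, coeff_mul_X_pow, coeff_mul_C, h2, zero_mul, sub_zero] at h1
  exact mem_support_iff.1 hd h1

theorem IsRemainder.unique {m : ℕ} {a : K} {g : TwistedPolynomial σ} {r r' : degreeLT σ m}
    (h : IsRemainder σ m a g r) (h' : IsRemainder σ m a g r') : r = r' := by
  rcases Nat.eq_zero_or_pos m with rfl | hm
  · apply Subtype.ext
    ext i
    rw [r.2 i (Nat.zero_le _), r'.2 i (Nat.zero_le _)]
  obtain ⟨s, hs⟩ := h
  obtain ⟨s', hs'⟩ := h'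
  have key : (s - s') * binomial σ m a = ((r' - r : degreeLT σ m) : TwistedPolynomial σ) := by
    rw [sub_mul, Submodule.coe_sub, sub_eq_sub_iff_add_eq_add, ← hs, add_comm, ← hs']
  have h0 : s - s' = 0 := eq_zero_of_mul_binomial_mem hm a _ (key ▸ (r' - r).2)
  rw [h0, zero_mul] at key
  have : r' - r = 0 := Subtype.ext key.symm
  exact (sub_eq_zero.1 this).symm

variable (σ)

open Classical in
/-- The remainder `g mod_r f` of the right division of `g` by `f = t^m - a`; it exists and is unique
for `m ≥ 1`. -/
def modr (m : ℕ) (a : K) (g : TwistedPolynomial σ) : degreeLT σ m :=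
  if h : ∃ r, IsRemainder σ m a g r then h.choose else 0

variable {σ}

theorem IsRemainder.modr_eq {m : ℕ} {a : K} {g : TwistedPolynomial σ} {r : degreeLT σ m}
    (h : IsRemainder σ m a g r) : modr σ m a g = r := by
  have he : ∃ r, IsRemainder σ m a g r := ⟨r, h⟩
  rw [modr, dif_pos he]
  exact he.choose_spec.unique h

theorem isRemainder_modr {m : ℕ} (hm : 0 < m) (a : K) (g : TwistedPolynomial σ) :
    IsRemainder σ m a g (modr σ m a g) := by
  obtain ⟨r, hr⟩ := exists_isRemainder hm a g
  rwa [hr.modr_eq]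

theorem degreeLT_zero_eq (r r' : degreeLT σ 0) : r = r' := by
  apply Subtype.ext
  ext i
  rw [r.2 i (Nat.zero_le _), r'.2 i (Nat.zero_le _)]

theorem modr_add (m : ℕ) (a : K) (g h : TwistedPolynomial σ) :
    modr σ m a (g + h) = modr σ m a g + modr σ m a h := by
  rcases Nat.eq_zero_or_pos m with rfl | hm
  · exact degreeLT_zero_eq _ _
  · exact ((isRemainder_modr hm a g).add (isRemainder_modr hm a h)).modr_eq

theorem modr_smul (m : ℕ) (a : K) (c : F) (g : TwistedPolynomial σ) :
    modr σ m a (c • g) = c • modr σ m a g := by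
  rcases Nat.eq_zero_or_pos m with rfl | hm
  · exact degreeLT_zero_eq _ _
  · exact ((isRemainder_modr hm a g).smul c).modr_eq

theorem modr_coe (m : ℕ) (a : K) (g : degreeLT σ m) :
    modr σ m a (g : TwistedPolynomial σ) = g :=
  IsRemainder.modr_eq ⟨0, by simp⟩

end Twisted

/-! ### Petit algebras -/

section PetitAlgebra

variable {F K : Type u} [Field F] [Field K] [Algebra F K]

/-- The Petit algebra `K[t;σ]/K[t;σ](t^m - a)`: the `F`-space `R_m` of twisted polynomials of
degree less than `m`, with the product `g ∘ h = gh mod_r (t^m - a)`. -/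
def PetitAlgebra (σ : K ≃ₐ[F] K) (m : ℕ) (_a : K) : Type u := degreeLT σ m

variable (σ : K ≃ₐ[F] K) (m : ℕ) (a : K)

instance : AddCommGroup (PetitAlgebra σ m a) := inferInstanceAs (AddCommGroup (degreeLT σ m))

instance : Module F (PetitAlgebra σ m a) := inferInstanceAs (Module F (degreeLT σ m))

variable {σ m a}

/-- The twisted polynomial of degree less than `m` underlying an element of the Petit algebra. -/
def PetitAlgebra.val (g : PetitAlgebra σ m a) : TwistedPolynomial σ :=
  Submodule.subtype (degreeLT σ m) g

variable (σ m a)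

/-- The class in the Petit algebra of a twisted polynomial, i.e. its remainder. -/
def PetitAlgebra.mk (g : TwistedPolynomial σ) : PetitAlgebra σ m a := modr σ m a g

variable {σ m a}

theorem PetitAlgebra.val_add (g h : PetitAlgebra σ m a) : (g + h).val = g.val + h.val := rfl

theorem PetitAlgebra.val_smul (c : F) (g : PetitAlgebra σ m a) : (c • g).val = c • g.val := rfl

theorem PetitAlgebra.val_zero : (0 : PetitAlgebra σ m a).val = 0 := rfl

theorem PetitAlgebra.mk_add (g h : TwistedPolynomial σ) :
    mk σ m a (g + h) = mk σ m a g + mk σ m a h := modr_add m a g h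

theorem PetitAlgebra.mk_smul (c : F) (g : TwistedPolynomial σ) :
    mk σ m a (c • g) = c • mk σ m a g := modr_smul m a c g

theorem PetitAlgebra.mk_val (g : PetitAlgebra σ m a) : mk σ m a g.val = g := modr_coe m a g

theorem PetitAlgebra.mk_zero : mk σ m a (0 : TwistedPolynomial σ) = 0 :=
  PetitAlgebra.mk_val 0

instance : Mul (PetitAlgebra σ m a) := ⟨fun g h => PetitAlgebra.mk σ m a (g.val * h.val)⟩

instance : One (PetitAlgebra σ m a) := ⟨PetitAlgebra.mk σ m a 1⟩

theorem PetitAlgebra.mul_def (g h : PetitAlgebra σ m a) :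
    g * h = PetitAlgebra.mk σ m a (g.val * h.val) := rfl

theorem PetitAlgebra.one_def : (1 : PetitAlgebra σ m a) = PetitAlgebra.mk σ m a 1 := rfl

/-- For `m ≥ 1` the unit of the Petit algebra is the constant polynomial `1`. -/
theorem PetitAlgebra.val_one (hm : 0 < m) : (1 : PetitAlgebra σ m a).val = 1 := by
  have h : (1 : TwistedPolynomial σ) ∈ degreeLT σ m := fun i hi => by
    rw [coeff_one, if_neg (by omega)]
  have h' := modr_coe m a (⟨1, h⟩ : degreeLT σ m)
  exact congrArg Subtype.val h'

theorem PetitAlgebra.eq_of_zero (g h : PetitAlgebra σ 0 a) : g = h :=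
  degreeLT_zero_eq (σ := σ) g h

instance : NonAssocRing (PetitAlgebra σ m a) :=
  { (inferInstance : AddCommGroup (PetitAlgebra σ m a)),
    (inferInstance : Mul (PetitAlgebra σ m a)),
    (inferInstance : One (PetitAlgebra σ m a)) with
    left_distrib := fun x y z => by
      simp only [PetitAlgebra.mul_def, PetitAlgebra.val_add, mul_add, PetitAlgebra.mk_add]
    right_distrib := fun x y z => by
      simp only [PetitAlgebra.mul_def, PetitAlgebra.val_add, add_mul, PetitAlgebra.mk_add]
    zero_mul := fun x => by
      simp only [PetitAlgebra.mul_def, PetitAlgebra.val_zero, zero_mul, PetitAlgebra.mk_zero]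
    mul_zero := fun x => by
      simp only [PetitAlgebra.mul_def, PetitAlgebra.val_zero, mul_zero, PetitAlgebra.mk_zero]
    one_mul := fun x => by
      rcases Nat.eq_zero_or_pos m with rfl | hm
      · exact PetitAlgebra.eq_of_zero _ _
      · rw [PetitAlgebra.mul_def, PetitAlgebra.val_one hm, one_mul, PetitAlgebra.mk_val]
    mul_one := fun x => by
      rcases Nat.eq_zero_or_pos m with rfl | hm
      · exact PetitAlgebra.eq_of_zero _ _
      · rw [PetitAlgebra.mul_def, PetitAlgebra.val_one hm, mul_one, PetitAlgebra.mk_val] }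

instance : IsScalarTower F (PetitAlgebra σ m a) (PetitAlgebra σ m a) where
  smul_assoc c x y := by
    simp only [smul_eq_mul, PetitAlgebra.mul_def, PetitAlgebra.val_smul]
    rw [← PetitAlgebra.mk_smul, smul_eq_C_mul σ c (x.val * y.val), smul_eq_C_mul σ c x.val,
      mul_assoc]

instance : SMulCommClass F (PetitAlgebra σ m a) (PetitAlgebra σ m a) where
  smul_comm c x y := by
    simp only [smul_eq_mul, PetitAlgebra.mul_def, PetitAlgebra.val_smul]
    rw [← PetitAlgebra.mk_smul, smul_eq_C_mul σ c (x.val * y.val), smul_eq_C_mul σ c y.val,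
      ← mul_assoc, ← mul_assoc, C_algebraMap_mul_comm]

end PetitAlgebra

/-- The nonassociative cyclic algebra `(K/F,σ,a) = K[t;σ]/K[t;σ](t^m - a)` of degree
`m = [K:F]`. -/
abbrev CyclicAlgebra {F K : Type u} [Field F] [Field K] [Algebra F K] (σ : K ≃ₐ[F] K) (a : K) :
    Type u :=
  PetitAlgebra σ (Module.finrank F K) a

/-! ### Nonassociative algebras

A unital nonassociative `F`-algebra is a `NonAssocRing` with a compatible `F`-module structure
(`IsScalarTower F A A` and `SMulCommClass F A A` say that the product is `F`-bilinear). -/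

section Nonassoc

/-- `A` is a division algebra: `A ≠ 0`, and left and right multiplication by every nonzero element
are bijective. -/
def IsDivision (A : Type u) [NonAssocRing A] : Prop :=
  Nontrivial A ∧ ∀ x : A, x ≠ 0 →
    Function.Bijective (fun y => x * y) ∧ Function.Bijective (fun y => y * x)

/-- `A` is a semifield: a finite-dimensional unital nonassociative division algebra over the finite
field `F`. -/
def IsSemifield (F A : Type u) [Field F] [NonAssocRing A] [Module F A] : Prop :=
  Finite F ∧ Module.Finite F A ∧ IsDivision A

/-- `A ≅ B` as nonassociative `F`-algebras. -/
def Iso (F A B : Type u) [Field F] [NonAssocRing A] [Module F A] [NonAssocRing B] [Module F B] :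
    Prop :=
  ∃ e : A ≃ₗ[F] B, ∀ x y, e (x * y) = e x * e y

/-- The left nucleus `{x | [x, A, A] = 0}`. -/
def leftNucleus (A : Type u) [NonAssocRing A] : Set A :=
  {x | ∀ y z, associator x y z = 0}

/-- The middle nucleus `{x | [A, x, A] = 0}`. -/
def middleNucleus (A : Type u) [NonAssocRing A] : Set A :=
  {x | ∀ y z, associator y x z = 0}

/-- The right nucleus `{x | [A, A, x] = 0}`. -/
def rightNucleus (A : Type u) [NonAssocRing A] : Set A :=
  {x | ∀ y z, associator y z x = 0}

/-- The subset `S` of the `F`-algebra `A` is a unital subalgebra isomorphic to `K` over `F`. -/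
def IsCopyOf (F K : Type u) {A : Type u} [Field F] [Field K] [Algebra F K] [NonAssocRing A]
    [Module F A] (S : Set A) : Prop :=
  ∃ f : K →ₗ[F] A, f 1 = 1 ∧ (∀ x y, f (x * y) = f x * f y) ∧ Function.Injective f ∧
    Set.range f = S

/-- `A` is a Sandler semifield over the finite field `F`: a semifield that is the opposite algebra
of a Petit algebra `K[t;σ]/K[t;σ](t^m - a)`, where `K/F` is a cyclic Galois extension of degree
`n ≥ m > 1` and `σ` generates `Gal(K/F)`. -/
def IsSandlerSemifield (F A : Type u) [Field F] [NonAssocRing A] [Module F A] : Prop :=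
  IsSemifield F A ∧
    ∃ (K : Type u) (_ : Field K) (_ : Algebra F K) (σ : K ≃ₐ[F] K) (m : ℕ) (a : K),
      FiniteDimensional F K ∧ IsGalois F K ∧ Subgroup.zpowers σ = ⊤ ∧
      1 < m ∧ m ≤ Module.finrank F K ∧ Iso F A (PetitAlgebra σ m a)ᵐᵒᵖ

end Nonassoc

/-! ### Counting Sandler semifields -/

/-- A Sandler semifield over `F` of order `N` with center `F` and left, middle and right nucleus
`K`. -/
structure SandlerSemifield (F K : Type u) [Field F] [Field K] [Algebra F K] (N : ℕ) where
  carrier : Type u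
  [ring : NonAssocRing carrier]
  [module : Module F carrier]
  [isScalarTower : IsScalarTower F carrier carrier]
  [smulCommClass : SMulCommClass F carrier carrier]
  isSandler : IsSandlerSemifield F carrier
  card_eq : Nat.card carrier = N
  center_eq : Set.center carrier = Set.range (fun c : F => c • (1 : carrier))
  leftNucleus_eq : IsCopyOf F K (leftNucleus carrier)
  middleNucleus_eq : IsCopyOf F K (middleNucleus carrier)
  rightNucleus_eq : IsCopyOf F K (rightNucleus carrier)

attribute [instance] SandlerSemifield.ring SandlerSemifield.module
  SandlerSemifield.isScalarTower SandlerSemifield.smulCommClass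

section Iso

variable {F A B D : Type u} [Field F] [NonAssocRing A] [Module F A] [NonAssocRing B] [Module F B]
  [NonAssocRing D] [Module F D]

theorem Iso.refl : Iso F A A := ⟨LinearEquiv.refl F A, fun _ _ => rfl⟩

theorem Iso.symm (h : Iso F A B) : Iso F B A := by
  obtain ⟨e, he⟩ := h
  exact ⟨e.symm, fun x y => e.injective (by simp [he])⟩

theorem Iso.trans (h : Iso F A B) (h' : Iso F B D) : Iso F A D := by
  obtain ⟨e, he⟩ := h
  obtain ⟨e', he'⟩ := h'
  exact ⟨e.trans e', fun x y => by simp [he, he']⟩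

end Iso

/-- Isomorphism of `F`-algebras as an equivalence relation. -/
instance SandlerSemifield.setoid (F K : Type u) [Field F] [Field K] [Algebra F K] (N : ℕ) :
    Setoid (SandlerSemifield F K N) where
  r A B := Iso F A.carrier B.carrier
  iseqv := ⟨fun _ => Iso.refl, Iso.symm, Iso.trans⟩

/-- The isomorphism classes of Sandler semifields over `F` of order `N` with center `F` and left,
middle and right nucleus `K`. -/
def SandlerClasses (F K : Type u) [Field F] [Field K] [Algebra F K] (N : ℕ) : Type (u + 1) :=
  Quotient (SandlerSemifield.setoid F K N)

end Petit

end

/-!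
Multiplication in `K[t;σ]/K[t;σ](t^d - a)` is determined by the rules
`(x t^i)(y t^j) = x σ^i(y) t^(i+j)` and `x t^(i+d) = x σ^i(a) t^i`, and everything is read off from
these rules on coefficients. Let `m = [K:F]` and let `σ` generate `Gal(K/F)`.

*Division.* In `K[t;σ]` the element `t^m` is central, and on the left module
`K[t;σ]/K[t;σ](t^m - a)` it acts diagonally with eigenvalues `σ^i(a)`. If these are distinct, the
module is simple (`eq_top_of_mul_mem`), and a zero divisor would produce a proper submodule
(`eq_zero_or_eq_zero_of_mul_eq_zero`). A generator of `Kˣ` has distinct conjugates, and if `m` is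
prime so does every `a ∉ F`. If `a ∈ F`, then `a` is the norm of some `b`, and `t - b` gives a zero
divisor (`not_isDivision_of_prod_eq`).

*Isomorphisms.* For `a ∉ F` the left nucleus is `K`. Hence an isomorphism `(K/F,σ,a) ≅ (K/F,σ',a')`
restricts to some `τ ∈ Gal(K/F)`, and it sends `t` to a monomial `k t^i` with `σ'^i = σ`. The
vanishing of certain associators forces `i = 1`, so `σ = σ'`, and the relation `t^m = a` becomes
`τ(a) = N(k) a'` (`eq_and_exists_of_iso`). Conversely each such pair `(τ, k)` gives an isomorphism
(`iso_of_twistedPow`). Since the norm of finite fields is surjective, isomorphism classes for a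
fixed `σ` are the orbits of `Gal(K/F) × Fˣ` on `K ∖ F`.

*Counting.* A Sandler semifield of order `q^(m^2)` with right nucleus `K` is opposite to some
`L[t;σ]/L[t;σ](t^d - a)`, where `L` lies in the right nucleus; so `d ≤ [L:F] ≤ m` and
`d [L:F] = m^2` leave only `d = [L:F] = m`, that is, `L ≅ K` (`SandlerSemifield.exists_iso`).
The orbits are counted with Burnside's lemma (`card_orbits_mul`): for prime `m` and `τ ≠ 1`, the
pair `(τ, c)` fixes `q - 1` elements of `K ∖ F` if `c` has order `m`, and none otherwise; and `Fˣ`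
has `m - 1` elements of order `m` or none, according to whether `m` divides `q - 1`.
-/

noncomputable section

namespace Petit

open SkewPolynomial

/-! ### Monomials and coefficients in Petit algebras -/

namespace PetitAlgebra

variable {F K : Type u} [Field F] [Field K] [Algebra F K] {σ : K ≃ₐ[F] K} {m : ℕ} {a : K}

/-- The coefficient of `t^i` in an element of the Petit algebra. -/
def coeff (i : ℕ) : PetitAlgebra σ m a →ₗ[F] K where
  toFun g := (toTwist σ).symm (g.val.coeff i)
  map_add' g h := by rw [val_add, SkewPolynomial.coeff_add, map_add]
  map_smul' c g := by
    rw [val_smul]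
    change (toTwist σ).symm (c • g.val.coeff i) = _
    rw [map_smul]
    rfl

variable (σ m a) in
/-- The class of the monomial `x t^i` in the Petit algebra; the exponent `i` is arbitrary. -/
def mono (i : ℕ) : K →ₗ[F] PetitAlgebra σ m a where
  toFun x := mk σ m a (monomial i (toTwist σ x))
  map_add' x y := by rw [map_add, SkewPolynomial.monomial_add, mk_add]
  map_smul' c x := by rw [map_smul, ← smul_monomial, mk_smul]; rfl

theorem val_mono {i : ℕ} (hi : i < m) (x : K) :
    (mono σ m a i x).val = monomial i (toTwist σ x) := by
  have h : monomial i (toTwist σ x) ∈ degreeLT σ m := fun j hj => by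
    rw [coeff_monomial, if_neg (by omega)]
  exact congrArg Subtype.val (modr_coe m a (⟨_, h⟩ : degreeLT σ m))

theorem coeff_mono {i : ℕ} (hi : i < m) (j : ℕ) (x : K) :
    coeff j (mono σ m a i x) = if i = j then x else 0 := by
  change (toTwist σ).symm ((mono σ m a i x).val.coeff j) = _
  rw [val_mono hi, coeff_monomial]
  split_ifs
  · exact (toTwist σ).symm_apply_apply x
  · exact map_zero _

theorem coeff_mono_self {i : ℕ} (hi : i < m) (x : K) : coeff i (mono σ m a i x) = x := by
  rw [coeff_mono hi, if_pos rfl]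

theorem ext_coeff {g h : PetitAlgebra σ m a} (H : ∀ i < m, coeff i g = coeff i h) : g = h := by
  apply Subtype.ext
  ext i
  by_cases hi : i < m
  · exact (toTwist σ).symm.injective (H i hi)
  · exact (g.2 i (by omega)).trans (h.2 i (by omega)).symm

theorem coeff_sum_mono {i : ℕ} (hi : i < m) (c : ℕ → K) :
    coeff i (∑ j ∈ Finset.range m, mono σ m a j (c j)) = c i := by
  rw [map_sum, Finset.sum_congr rfl (fun j hj => coeff_mono (Finset.mem_range.1 hj) i (c j)),
    Finset.sum_ite_eq' (Finset.range m) i c, if_pos (Finset.mem_range.2 hi)]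

theorem sum_mono_coeff (g : PetitAlgebra σ m a) :
    ∑ i ∈ Finset.range m, mono σ m a i (coeff i g) = g :=
  ext_coeff fun _ hi => coeff_sum_mono hi _

theorem mono_injective {i : ℕ} (hi : i < m) : Function.Injective (mono σ m a i) := fun x y h => by
  rw [← coeff_mono_self (σ := σ) (a := a) hi x, h, coeff_mono_self hi]

theorem mono_eq_zero_iff {i : ℕ} (hi : i < m) {x : K} : mono σ m a i x = 0 ↔ x = 0 :=
  map_eq_zero_iff _ (mono_injective hi)

variable (σ m a) in
/-- The coordinates of an element of the Petit algebra. -/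
def coeffEquiv : PetitAlgebra σ m a ≃ₗ[F] (Fin m → K) where
  toFun g i := coeff i g
  map_add' _ _ := by ext; simp
  map_smul' _ _ := by ext; simp
  invFun c := ∑ i : Fin m, mono σ m a i (c i)
  left_inv g := by
    change ∑ i : Fin m, mono σ m a i (coeff i g) = g
    rw [Fin.sum_univ_eq_sum_range (fun i => mono σ m a i (coeff i g)), sum_mono_coeff]
  right_inv c := by
    ext j
    simp [map_sum, coeff_mono, ← Fin.ext_iff]

theorem finrank_eq [FiniteDimensional F K] :
    Module.finrank F (PetitAlgebra σ m a) = m * Module.finrank F K := by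
  rw [(coeffEquiv σ m a).finrank_eq, Module.finrank_pi_fintype]
  simp

instance [FiniteDimensional F K] : Module.Finite F (PetitAlgebra σ m a) :=
  Module.Finite.equiv (coeffEquiv σ m a).symm

@[elab_as_elim]
theorem mono_induction {p : PetitAlgebra σ m a → Prop} (g : PetitAlgebra σ m a) (zero : p 0)
    (add : ∀ g h, p g → p h → p (g + h)) (mono : ∀ i < m, ∀ x, p (mono σ m a i x)) : p g := by
  rw [← sum_mono_coeff g]
  exact Finset.sum_induction _ p add zero fun i hi => mono i (Finset.mem_range.1 hi) _

/-- The relation `t^m = a`. -/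
theorem mono_add_degree (i : ℕ) (x : K) :
    mono σ m a (i + m) x = mono σ m a i (x * (σ ^ i) a) := by
  rcases Nat.eq_zero_or_pos m with rfl | hm
  · exact eq_of_zero _ _
  have h : monomial (i + m) (toTwist σ x) = monomial i (toTwist σ x) * binomial σ m a +
      monomial i (toTwist σ (x * (σ ^ i) a)) := by
    rw [binomial, mul_sub, monomial_mul_X_pow, monomial_mul_C, φ_iterate_apply, twist_smul,
      map_mul (toTwist σ)]
    abel
  obtain ⟨s, hs⟩ := isRemainder_modr hm a (monomial i (toTwist σ (x * (σ ^ i) a)))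
  refine IsRemainder.modr_eq ⟨monomial i (toTwist σ x) + s, ?_⟩
  rw [h, add_mul, add_assoc]
  congr 1

theorem mono_degree (x : K) : mono σ m a m x = mono σ m a 0 (x * a) := by
  have h := mono_add_degree (σ := σ) (m := m) (a := a) 0 x
  rwa [Nat.zero_add] at h

theorem mono_mul_mono {i j : ℕ} (hi : i < m) (hj : j < m) (x y : K) :
    mono σ m a i x * mono σ m a j y = mono σ m a (i + j) (x * (σ ^ i) y) := by
  rw [mul_def, val_mono hi, val_mono hj, monomial_mul_monomial, φ_iterate_apply, twist_smul,
    ← map_mul]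
  rfl

/-- The rule `(x t^i)(y t^j) = x σ^i(y) t^(i+j)` holds in the left module `K[t;σ]/K[t;σ](t^m - a)`,
so the second exponent need not be reduced. -/
theorem mono_mul_mono' {i : ℕ} (hi : i < m) (j : ℕ) (x y : K) :
    mono σ m a i x * mono σ m a j y = mono σ m a (i + j) (x * (σ ^ i) y) := by
  induction j using Nat.strong_induction_on generalizing y with
  | _ j ih =>
    by_cases hj : j < m
    · exact mono_mul_mono hi hj x y
    · obtain ⟨k, rfl⟩ := Nat.exists_eq_add_of_le' (not_lt.1 hj)
      rw [mono_add_degree, ih k (by omega), ← add_assoc, mono_add_degree, map_mul (σ ^ i),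
        ← AlgEquiv.mul_apply, ← pow_add, mul_assoc]

theorem one_eq_mono : (1 : PetitAlgebra σ m a) = mono σ m a 0 1 := rfl

theorem mono_zero_mul (x : K) (g : PetitAlgebra σ m a) (i : ℕ) :
    coeff i (mono σ m a 0 x * g) = x * coeff i g := by
  induction g using mono_induction with
  | zero => simp
  | add g h hg hh => rw [mul_add, map_add, hg, hh, map_add, mul_add]
  | mono j hj y =>
    rw [mono_mul_mono (by omega) hj, zero_add, coeff_mono hj, coeff_mono hj]
    split_ifs <;> simp

theorem mul_mono_zero (g : PetitAlgebra σ m a) (x : K) (i : ℕ) :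
    coeff i (g * mono σ m a 0 x) = coeff i g * (σ ^ i) x := by
  induction g using mono_induction with
  | zero => simp
  | add g h hg hh => rw [add_mul, map_add, hg, hh, map_add, add_mul]
  | mono j hj y =>
    rw [mono_mul_mono hj (by omega), add_zero, coeff_mono hj, coeff_mono hj]
    split_ifs with h
    · rw [h]
    · simp

/-- A linear map on a Petit algebra that is multiplicative on monomials is multiplicative. -/
theorem map_mul_of_mono {B : Type u} [NonAssocRing B] [Module F B] (f : PetitAlgebra σ m a →ₗ[F] B)
    (H : ∀ i < m, ∀ j < m, ∀ x y, f (mono σ m a i x * mono σ m a j y) =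
      f (mono σ m a i x) * f (mono σ m a j y)) (g h : PetitAlgebra σ m a) :
    f (g * h) = f g * f h := by
  induction g using mono_induction with
  | zero => simp
  | add g g' hg hg' => rw [add_mul, map_add, map_add, add_mul, hg, hg']
  | mono i hi x =>
    induction h using mono_induction with
    | zero => simp
    | add h h' hh hh' => rw [mul_add, map_add, map_add, mul_add, hh, hh']
    | mono j hj y => exact H i hi j hj x y

/-- A biadditive map on a Petit algebra that vanishes on monomials vanishes. -/
theorem biadditive_eq_zero_of_mono
    {f : PetitAlgebra σ m a → PetitAlgebra σ m a → PetitAlgebra σ m a}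
    (hl : ∀ g g' h, f (g + g') h = f g h + f g' h) (hr : ∀ g h h', f g (h + h') = f g h + f g h')
    (H : ∀ i < m, ∀ j < m, ∀ x y, f (mono σ m a i x) (mono σ m a j y) = 0)
    (g h : PetitAlgebra σ m a) : f g h = 0 := by
  induction g using mono_induction with
  | zero => simpa using hl 0 0 h
  | add g g' hg hg' => rw [hl, hg, hg', add_zero]
  | mono i hi x =>
    induction h using mono_induction with
    | zero => simpa using hr (mono σ m a i x) 0 0
    | add h h' hh hh' => rw [hr, hh, hh', add_zero]
    | mono j hj y => exact H i hi j hj x y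

/-! ### Nuclei -/

theorem mono_zero_mem_leftNucleus (hm : 0 < m) (x : K) :
    mono σ m a 0 x ∈ leftNucleus (PetitAlgebra σ m a) := by
  refine biadditive_eq_zero_of_mono (fun g g' h => ?_) (fun g h h' => ?_) fun i hi j hj y z => ?_
  · simp only [associator_apply, add_mul, mul_add]; abel
  · simp only [associator_apply, mul_add]; abel
  · rw [associator_apply, mono_mul_mono hm hi, zero_add, mono_mul_mono hi hj, mono_mul_mono hi hj,
      sub_eq_zero]
    refine ext_coeff fun l hl => ?_
    rw [mono_zero_mul, pow_zero, AlgEquiv.one_apply]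
    by_cases h : i + j < m
    · rw [coeff_mono h, coeff_mono h]
      split_ifs
      · ring
      · simp
    · obtain ⟨k, hk⟩ := Nat.exists_eq_add_of_le' (not_lt.1 h)
      rw [hk, mono_add_degree, mono_add_degree, coeff_mono (by omega), coeff_mono (by omega)]
      split_ifs
      · ring
      · simp

theorem mono_zero_mem_middleNucleus (hm : 0 < m) (x : K) :
    mono σ m a 0 x ∈ middleNucleus (PetitAlgebra σ m a) := by
  refine biadditive_eq_zero_of_mono (fun g g' h => ?_) (fun g h h' => ?_) fun i hi j hj y z => ?_
  · simp only [associator_apply, add_mul]; abel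
  · simp only [associator_apply, mul_add]; abel
  · rw [associator_apply, mono_mul_mono hi hm, add_zero, mono_mul_mono hm hj, zero_add,
      mono_mul_mono hi hj, mono_mul_mono hi hj, pow_zero, AlgEquiv.one_apply, map_mul (σ ^ i),
      mul_assoc, sub_self]

theorem mono_zero_mem_rightNucleus (hm : 0 < m) (hσ : σ ^ m = 1) (x : K) :
    mono σ m a 0 x ∈ rightNucleus (PetitAlgebra σ m a) := by
  refine biadditive_eq_zero_of_mono (fun g g' h => ?_) (fun g h h' => ?_) fun i hi j hj y z => ?_
  · simp only [associator_apply, add_mul]; abel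
  · simp only [associator_apply, mul_add, add_mul]; abel
  · rw [associator_apply, mono_mul_mono hj hm, add_zero, mono_mul_mono hi hj, mono_mul_mono hi hj,
      map_mul (σ ^ i), ← AlgEquiv.mul_apply, ← pow_add, sub_eq_zero]
    refine ext_coeff fun l hl => ?_
    rw [mul_mono_zero]
    by_cases h : i + j < m
    · rw [coeff_mono h, coeff_mono h]
      split_ifs with hl'
      · rw [← hl']; ring
      · simp
    · obtain ⟨k, hk⟩ := Nat.exists_eq_add_of_le' (not_lt.1 h)
      rw [hk, mono_add_degree, mono_add_degree, coeff_mono (by omega), coeff_mono (by omega),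
        pow_add, hσ, mul_one]
      split_ifs with hl'
      · rw [← hl']; ring
      · simp

theorem eq_mono_zero {u : PetitAlgebra σ m a} (h : ∀ i < m, 0 < i → coeff i u = 0) :
    u = mono σ m a 0 (coeff 0 u) := by
  refine ext_coeff fun i hi => ?_
  rcases Nat.eq_zero_or_pos i with rfl | h0
  · rw [coeff_mono_self hi]
  · rw [h i hi h0, coeff_mono (by omega), if_neg (by omega)]

theorem coeff_mul_mono_pred_mul_mono_one (hm : 1 < m) (k : ℕ)
    (g : PetitAlgebra σ m a) :
    coeff (k + 1) (g * mono σ m a (m - 1) 1 * mono σ m a 1 1) = coeff (k + 1) g * (σ ^ k) a := by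
  induction g using mono_induction with
  | zero => simp
  | add g g' hg hg' => rw [add_mul, add_mul, map_add, hg, hg', map_add, add_mul]
  | mono j hj x =>
    rw [mono_mul_mono hj (by omega), map_one, mul_one, coeff_mono hj]
    rcases j with _ | j
    · rw [zero_add, mono_mul_mono (by omega) hm, Nat.sub_add_cancel hm.le, mono_degree,
        coeff_mono (by omega)]
      simp
    · rw [show j + 1 + (m - 1) = j + m by omega, mono_add_degree, mono_mul_mono (by omega) hm,
        coeff_mono hj, map_one, mul_one]
      split_ifs with h
      · rw [Nat.succ_injective h]
      · simp

theorem coeff_mono_pred_mul_mul_mono_one (hm : 1 < m) (k : ℕ)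
    (g : PetitAlgebra σ m a) :
    coeff (k + 1) (mono σ m a (m - 1) 1 * g * mono σ m a 1 1) =
      (σ ^ (m - 1)) (coeff (k + 1) g) * (σ ^ k) a := by
  induction g using mono_induction with
  | zero => simp
  | add g g' hg hg' =>
    rw [mul_add, add_mul, map_add, hg, hg', map_add, map_add (σ ^ (m - 1)), add_mul]
  | mono j hj x =>
    rw [mono_mul_mono (by omega) hj, one_mul, coeff_mono hj]
    rcases j with _ | j
    · rw [add_zero, mono_mul_mono (by omega) hm, Nat.sub_add_cancel hm.le, mono_degree,
        coeff_mono (by omega)]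
      simp
    · rw [show m - 1 + (j + 1) = j + m by omega, mono_add_degree, mono_mul_mono (by omega) hm,
        coeff_mono hj, map_one, mul_one]
      split_ifs with h
      · rw [Nat.succ_injective h]
      · simp

theorem coeff_mono_pred_mul_mul_mono_one' (hm : 1 < m) (k : ℕ)
    (g : PetitAlgebra σ m a) :
    coeff (k + 1) (mono σ m a (m - 1) 1 * (g * mono σ m a 1 1)) =
      (σ ^ (m - 1)) (coeff (k + 1) g) * (σ ^ (k + 1)) a := by
  induction g using mono_induction with
  | zero => simp
  | add g g' hg hg' =>
    rw [add_mul, mul_add, map_add, hg, hg', map_add, map_add (σ ^ (m - 1)), add_mul]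
  | mono j hj x =>
    rw [mono_mul_mono hj hm, map_one (σ ^ j), mul_one, coeff_mono hj]
    rcases Nat.lt_or_eq_of_le (Nat.succ_le_of_lt hj) with hj' | hj'
    · rw [mono_mul_mono (by omega) hj', one_mul, show m - 1 + (j + 1) = j + m by omega,
        mono_add_degree, coeff_mono hj]
      split_ifs with h
      · rw [h]
      · simp
    · rw [show j + 1 = m by omega, mono_degree, mono_mul_mono (by omega) (by omega), one_mul,
        add_zero, coeff_mono (by omega), map_mul]
      rw [show m - 1 = j by omega]
      split_ifs with h
      · rw [h]
      · simp

theorem coeff_mono_one_mul_mono_pred_mul (hm : 1 < m) (hσ : σ ^ m = 1) (k : ℕ)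
    (g : PetitAlgebra σ m a) :
    coeff (k + 1) (mono σ m a 1 1 * (mono σ m a (m - 1) 1 * g)) =
      coeff (k + 1) g * (σ ^ (k + 1)) a := by
  have hσ' (x : K) : σ ((σ ^ (m - 1)) x) = x := by
    rw [← AlgEquiv.mul_apply, ← pow_succ', Nat.sub_add_cancel hm.le, hσ, AlgEquiv.one_apply]
  induction g using mono_induction with
  | zero => simp
  | add g g' hg hg' => rw [mul_add, mul_add, map_add, hg, hg', map_add, add_mul]
  | mono j hj x =>
    rw [mono_mul_mono (by omega) hj, one_mul, coeff_mono hj]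
    rcases j with _ | j
    · rw [add_zero, mono_mul_mono hm (by omega), show 1 + (m - 1) = m by omega,
        mono_degree, coeff_mono (by omega)]
      simp
    · rw [show m - 1 + (j + 1) = j + m by omega, mono_add_degree, mono_mul_mono hm (by omega),
        add_comm 1 j, coeff_mono hj, one_mul, pow_one, map_mul, hσ', ← AlgEquiv.mul_apply,
        ← pow_succ']
      split_ifs with h
      · rw [h]
      · simp

theorem pow_apply_ne_pow_succ_apply (ha : σ a ≠ a) (k : ℕ) : (σ ^ k) a ≠ (σ ^ (k + 1)) a := by
  rw [pow_succ, AlgEquiv.mul_apply]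
  exact fun h => ha ((σ ^ k).injective h).symm

/-- For an element of the left nucleus with coefficients `u_i`, comparing `(u t^(m-1)) t` with
`u (t^(m-1) t) = u a` gives `u_i σ^(i-1)(a) = u_i σ^i(a)` for `i > 0`. -/
theorem eq_mono_zero_of_mem_leftNucleus (hm : 1 < m) (ha : σ a ≠ a) {u : PetitAlgebra σ m a}
    (hu : u ∈ leftNucleus (PetitAlgebra σ m a)) : u = mono σ m a 0 (coeff 0 u) := by
  refine eq_mono_zero fun i hi h0 => ?_
  obtain ⟨k, rfl⟩ := Nat.exists_eq_add_of_le' h0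
  have h := congrArg (coeff (k + 1)) (hu (mono σ m a (m - 1) 1) (mono σ m a 1 1))
  rw [associator_apply, map_sub, coeff_mul_mono_pred_mul_mono_one hm,
    mono_mul_mono (by omega) hm, Nat.sub_add_cancel hm.le, mono_degree, mul_mono_zero, map_zero,
    map_one, one_mul, one_mul, ← mul_sub] at h
  exact (mul_eq_zero.1 h).resolve_right (sub_ne_zero.2 (pow_apply_ne_pow_succ_apply ha k))

/-- For an element of the middle nucleus with coefficients `u_i`, comparing `(t^(m-1) u) t` with
`t^(m-1) (u t)` gives `u_i = 0` for `i > 0`. -/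
theorem eq_mono_zero_of_mem_middleNucleus (hm : 1 < m) (ha : σ a ≠ a) {u : PetitAlgebra σ m a}
    (hu : u ∈ middleNucleus (PetitAlgebra σ m a)) : u = mono σ m a 0 (coeff 0 u) := by
  refine eq_mono_zero fun i hi h0 => ?_
  obtain ⟨k, rfl⟩ := Nat.exists_eq_add_of_le' h0
  have h := congrArg (coeff (k + 1)) (hu (mono σ m a (m - 1) 1) (mono σ m a 1 1))
  rw [associator_apply, map_sub, coeff_mono_pred_mul_mul_mono_one hm,
    coeff_mono_pred_mul_mul_mono_one' hm, map_zero, ← mul_sub] at h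
  exact (map_eq_zero_iff _ (σ ^ (m - 1)).injective).1
    ((mul_eq_zero.1 h).resolve_right (sub_ne_zero.2 (pow_apply_ne_pow_succ_apply ha k)))

/-- For an element of the right nucleus with coefficients `u_i`, comparing `(t t^(m-1)) u = a u`
with `t (t^(m-1) u)` gives `a u_i = u_i σ^i(a)` for `i > 0`. -/
theorem eq_mono_zero_of_mem_rightNucleus (hm : 1 < m) (hσ : σ ^ m = 1)
    (ha : ∀ i < m, 0 < i → (σ ^ i) a ≠ a) {u : PetitAlgebra σ m a}
    (hu : u ∈ rightNucleus (PetitAlgebra σ m a)) : u = mono σ m a 0 (coeff 0 u) := by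
  refine eq_mono_zero fun i hi h0 => ?_
  obtain ⟨k, rfl⟩ := Nat.exists_eq_add_of_le' h0
  have h := congrArg (coeff (k + 1)) (hu (mono σ m a 1 1) (mono σ m a (m - 1) 1))
  rw [associator_apply, map_sub, coeff_mono_one_mul_mono_pred_mul hm hσ,
    mono_mul_mono hm (by omega), show 1 + (m - 1) = m by omega, mono_degree, map_one,
    mul_one, one_mul, mono_zero_mul, map_zero, mul_comm a,
    ← mul_sub] at h
  exact (mul_eq_zero.1 h).resolve_right (sub_ne_zero.2 (ha _ hi h0).symm)

theorem leftNucleus_eq_range (hm : 1 < m) (ha : σ a ≠ a) :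
    leftNucleus (PetitAlgebra σ m a) = Set.range (mono σ m a 0) :=
  Set.Subset.antisymm (fun _ hu => ⟨_, (eq_mono_zero_of_mem_leftNucleus hm ha hu).symm⟩)
    (Set.range_subset_iff.2 (mono_zero_mem_leftNucleus (by omega)))

theorem middleNucleus_eq_range (hm : 1 < m) (ha : σ a ≠ a) :
    middleNucleus (PetitAlgebra σ m a) = Set.range (mono σ m a 0) :=
  Set.Subset.antisymm (fun _ hu => ⟨_, (eq_mono_zero_of_mem_middleNucleus hm ha hu).symm⟩)
    (Set.range_subset_iff.2 (mono_zero_mem_middleNucleus (by omega)))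

theorem rightNucleus_eq_range (hm : 1 < m) (hσ : σ ^ m = 1)
    (ha : ∀ i < m, 0 < i → (σ ^ i) a ≠ a) :
    rightNucleus (PetitAlgebra σ m a) = Set.range (mono σ m a 0) :=
  Set.Subset.antisymm (fun _ hu => ⟨_, (eq_mono_zero_of_mem_rightNucleus hm hσ ha hu).symm⟩)
    (Set.range_subset_iff.2 (mono_zero_mem_rightNucleus (by omega) hσ))

theorem mono_zero_mul_mono_zero (hm : 0 < m) (x y : K) :
    mono σ m a 0 x * mono σ m a 0 y = mono σ m a 0 (x * y) := by
  rw [mono_mul_mono hm hm]; rfl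

theorem mono_zero_algebraMap (c : F) :
    mono σ m a 0 (algebraMap F K c) = c • (1 : PetitAlgebra σ m a) := by
  rw [one_eq_mono, ← map_smul, Algebra.algebraMap_eq_smul_one]

theorem center_eq_range (hm : 1 < m) (ha : σ a ≠ a)
    (hfix : ∀ x : K, σ x = x → x ∈ Set.range (algebraMap F K)) :
    Set.center (PetitAlgebra σ m a) = Set.range fun c : F => c • (1 : PetitAlgebra σ m a) := by
  refine Set.Subset.antisymm (fun u hu => ?_) (Set.range_subset_iff.2 fun c => ?_)
  · have hu0 : u = mono σ m a 0 (coeff 0 u) := eq_mono_zero_of_mem_leftNucleus hm ha fun y z =>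
      sub_eq_zero.2 (hu.left_assoc y z).symm
    have h : u * mono σ m a 1 1 = mono σ m a 1 1 * u := hu.comm _
    rw [hu0, mono_mul_mono (by omega) hm, mono_mul_mono hm (by omega)] at h
    have h1 := mono_injective (i := 1) hm h
    rw [map_one, mul_one, one_mul, pow_one] at h1
    obtain ⟨c, hc⟩ := hfix _ h1.symm
    exact ⟨c, by rw [hu0, ← hc]; exact (mono_zero_algebraMap c).symm⟩
  · rw [Set.mem_center_iff]
    refine ⟨fun g => ?_, fun g h => ?_, fun g h => ?_⟩
    · rw [commute_iff_eq, smul_mul_assoc, mul_smul_comm, one_mul, mul_one]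
    · simp only [smul_mul_assoc, one_mul]
    · simp only [mul_smul_comm, mul_one]

theorem isCopyOf_range (hm : 0 < m) : IsCopyOf F K (Set.range (mono σ m a 0)) :=
  ⟨mono σ m a 0, rfl, fun x y => (mono_zero_mul_mono_zero hm x y).symm, mono_injective hm, rfl⟩

/-! ### Division Petit algebras -/

theorem mulLeft_pow_mono (hm : 1 < m) (i j : ℕ) (x : K) :
    (LinearMap.mulLeft F (mono σ m a 1 1) ^ i) (mono σ m a j x) =
      mono σ m a (j + i) ((σ ^ i) x) := by
  induction i with
  | zero => rfl
  | succ i ih =>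
    rw [pow_succ', Module.End.mul_apply, ih, LinearMap.mulLeft_apply, mono_mul_mono' hm, one_mul,
      pow_one, pow_succ', AlgEquiv.mul_apply, add_comm 1, add_assoc]

/-- For `i < m`, left multiplication by `x t^i` in the Petit algebra is the action of `x t^i` on the
left module `K[t;σ]/K[t;σ](t^m - a)`. -/
theorem mono_mul_eq (hm : 1 < m) {i : ℕ} (hi : i < m) (x : K) (h : PetitAlgebra σ m a) :
    mono σ m a i x * h =
      mono σ m a 0 x * (LinearMap.mulLeft F (mono σ m a 1 1) ^ i) h := by
  induction h using mono_induction with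
  | zero => simp
  | add g h hg hh => rw [mul_add, hg, hh, map_add, mul_add]
  | mono j hj y =>
    rw [mulLeft_pow_mono hm, mono_mul_mono hi hj, mono_mul_mono' (by omega), pow_zero,
      AlgEquiv.one_apply, zero_add, add_comm]

/-- In degree `m` with `σ^m = 1` the element `t^m` is central in the twisted polynomial ring, so
acting with it is right multiplication by `a`. -/
theorem mulLeft_pow_degree (hm : 1 < m) (hσ : σ ^ m = 1) (h : PetitAlgebra σ m a) :
    (LinearMap.mulLeft F (mono σ m a 1 1) ^ m) h = h * mono σ m a 0 a := by
  induction h using mono_induction with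
  | zero => simp
  | add g h hg hh => rw [map_add, hg, hh, add_mul]
  | mono j hj y =>
    rw [mulLeft_pow_mono hm, hσ, AlgEquiv.one_apply, mono_add_degree, mono_mul_mono hj (by omega),
      add_zero]

theorem mono_zero_mul_mono_one (hm : 1 < m) (x : K) (g : PetitAlgebra σ m a) :
    mono σ m a 1 1 * (mono σ m a 0 x * g) = mono σ m a 0 (σ x) * (mono σ m a 1 1 * g) := by
  have h := mono_zero_mem_leftNucleus (σ := σ) (a := a) (by omega : 0 < m) (σ x) (mono σ m a 1 1) g
  have h' := mono_zero_mem_middleNucleus (σ := σ) (a := a) (by omega : 0 < m) x (mono σ m a 1 1) g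
  rw [associator_apply, sub_eq_zero] at h h'
  rw [← h, ← h', mono_mul_mono hm (by omega), mono_mul_mono (by omega) hm]
  simp

/-- If the conjugates `σ^i(a)`, `i < m`, are distinct, then the left module
`K[t;σ]/K[t;σ](t^m - a)` is simple. The eigenvalues `σ^i(a)` of `t^m` on it are distinct, so a
nonzero submodule contains one of the monomials, hence all of them. -/
theorem eq_top_of_mul_mem (hm : 1 < m) (hσ : σ ^ m = 1)
    (ha : ∀ i < m, ∀ j < m, i ≠ j → (σ ^ i) a ≠ (σ ^ j) a) (N : AddSubgroup (PetitAlgebra σ m a))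
    (hK : ∀ x, ∀ u ∈ N, mono σ m a 0 x * u ∈ N) (hT : ∀ u ∈ N, mono σ m a 1 1 * u ∈ N)
    (hN : N ≠ ⊥) : N = ⊤ := by
  classical
  have hTpow (i : ℕ) : ∀ u ∈ N, (LinearMap.mulLeft F (mono σ m a 1 1) ^ i) u ∈ N := by
    induction i with
    | zero => exact fun u hu => hu
    | succ i ih =>
      intro u hu
      rw [pow_succ', Module.End.mul_apply]
      exact hT _ (ih u hu)
  have ha0 : a ≠ 0 := fun h => ha 0 (by omega) 1 hm (by omega) (by simp [h])
  let supp (u : PetitAlgebra σ m a) : Finset ℕ := {i ∈ Finset.range m | coeff i u ≠ 0}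
  have hsupp {u : PetitAlgebra σ m a} {i : ℕ} : i ∈ supp u ↔ i < m ∧ coeff i u ≠ 0 := by
    simp [supp]
  -- a nonzero element of `N` with as few monomials as possible
  obtain ⟨u, ⟨huN, hu0⟩, hmin⟩ : ∃ u, (u ∈ N ∧ u ≠ 0) ∧ ∀ v, v ∈ N ∧ v ≠ 0 →
      (supp u).card ≤ (supp v).card := by
    obtain ⟨u, hu⟩ := AddSubgroup.ne_bot_iff_exists_ne_zero.1 hN
    have := exists_minimal_of_wellFoundedLT (fun k => ∃ u, (u ∈ N ∧ u ≠ 0) ∧ (supp u).card = k)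
      ⟨_, u.1, ⟨u.2, fun h => hu (Subtype.ext h)⟩, rfl⟩
    obtain ⟨k, ⟨v, hv, rfl⟩, hk⟩ := this
    refine ⟨v, hv, fun w hw => ?_⟩
    by_contra hlt
    exact hlt (hk ⟨w, hw, rfl⟩ (by omega))
  obtain ⟨i, hi⟩ : (supp u).Nonempty := by
    rw [Finset.nonempty_iff_ne_empty]
    intro h
    refine hu0 (ext_coeff fun i hi => ?_)
    by_contra hc
    have : i ∈ supp u := hsupp.2 ⟨hi, by simpa using hc⟩
    simp [h] at this
  obtain ⟨him, hci⟩ := hsupp.1 hi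
  have hone : ∀ j < m, j ≠ i → coeff j u = 0 := by
    intro j hj hji
    by_contra hc
    set w := u * mono σ m a 0 a - mono σ m a 0 ((σ ^ i) a) * u with hw
    have hcw (l : ℕ) : coeff l w = coeff l u * ((σ ^ l) a - (σ ^ i) a) := by
      rw [hw, map_sub, mul_mono_zero, mono_zero_mul]; ring
    have hwN : w ∈ N := by
      rw [hw, ← mulLeft_pow_degree hm hσ]
      exact N.sub_mem (hTpow m u huN) (hK _ u huN)
    have hw0 : w ≠ 0 := fun h => by
      have := hcw j
      rw [h, map_zero] at this
      exact mul_ne_zero hc (sub_ne_zero.2 (ha j hj i him hji)) this.symm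
    have hlt : supp w ⊂ supp u := by
      refine Finset.ssubset_iff_of_subset (fun l hl => ?_) |>.2 ⟨i, hi, fun hi' => ?_⟩
      · rw [hsupp, hcw] at hl
        exact hsupp.2 ⟨hl.1, left_ne_zero_of_mul hl.2⟩
      · rw [hsupp, hcw, sub_self, mul_zero] at hi'
        exact hi'.2 rfl
    exact (Finset.card_lt_card hlt).not_ge (hmin w ⟨hwN, hw0⟩)
  have hu : u = mono σ m a i (coeff i u) := ext_coeff fun j hj => by
    rw [coeff_mono him]
    split_ifs with h
    · rw [h]
    · exact hone j hj (Ne.symm h)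
  have hmono (l : ℕ) (x : K) : mono σ m a l x ∈ N := by
    have h1 := hTpow (l + m - i) u huN
    rw [hu, mulLeft_pow_mono hm, show i + (l + m - i) = l + m by omega, mono_add_degree] at h1
    set c := (σ ^ (l + m - i)) (coeff i u) * (σ ^ l) a with hc
    have hc0 : c ≠ 0 :=
      mul_ne_zero ((map_ne_zero_iff _ (σ ^ _).injective).2 hci)
        ((map_ne_zero_iff _ (σ ^ l).injective).2 ha0)
    have h2 := hK (x * c⁻¹) _ h1
    rwa [mono_mul_mono' (by omega), pow_zero, AlgEquiv.one_apply, zero_add,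
      inv_mul_cancel_right₀ hc0] at h2
  rw [eq_top_iff]
  intro g _
  rw [← sum_mono_coeff g]
  exact N.sum_mem fun l _ => hmono l _

/-- If `g h = 0` with `g` of degree `r < m`, then `h, th, …, t^(r-1) h` span a submodule of
`K[t;σ]/K[t;σ](t^m - a)`. It is contained in the image of right multiplication by `h`, which is
not surjective, contradicting simplicity of the module. -/
theorem eq_zero_or_eq_zero_of_mul_eq_zero [Finite K] (hm : 1 < m) (hσ : σ ^ m = 1)
    (ha : ∀ i < m, ∀ j < m, i ≠ j → (σ ^ i) a ≠ (σ ^ j) a) {g h : PetitAlgebra σ m a}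
    (hgh : g * h = 0) : g = 0 ∨ h = 0 := by
  classical
  by_contra! hne
  obtain ⟨hg, hh⟩ := hne
  set T := LinearMap.mulLeft F (mono σ m a 1 1) with hTdef
  have : Finite (PetitAlgebra σ m a) := Finite.of_injective _ (coeffEquiv σ m a).injective
  -- the degree `r` of `g`
  obtain ⟨r, ⟨hrm, hr⟩, hmax⟩ : ∃ r, (r < m ∧ coeff r g ≠ 0) ∧ ∀ i < m, r < i → coeff i g = 0 := by
    have hne : ({i ∈ Finset.range m | coeff i g ≠ 0} : Finset ℕ).Nonempty := by
      by_contra hempty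
      refine hg (ext_coeff fun i hi => ?_)
      by_contra hc
      exact hempty ⟨i, by simpa using ⟨hi, hc⟩⟩
    obtain ⟨r, hr, hmax⟩ := Finset.exists_max_image _ id hne
    refine ⟨r, by simpa using hr, fun i hi hri => ?_⟩
    by_contra hc
    have := hmax i (by simpa using ⟨hi, hc⟩)
    simp only [id] at this
    omega
  -- the `K`-span of `h, th, …, t^(r-1) h`, which is a submodule because `g` annihilates `h`
  set S : Set (PetitAlgebra σ m a) := {v | ∃ i < r, ∃ x, v = mono σ m a 0 x * (T ^ i) h} with hS
  set N := AddSubgroup.closure S with hN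
  have hgen {i : ℕ} (hi : i < r) (x : K) : mono σ m a 0 x * (T ^ i) h ∈ N :=
    AddSubgroup.subset_closure ⟨i, hi, x, rfl⟩
  have hassoc (x y : K) (u : PetitAlgebra σ m a) :
      mono σ m a 0 x * (mono σ m a 0 y * u) = mono σ m a 0 (x * y) * u := by
    rw [← mono_zero_mul_mono_zero (by omega)]
    exact (sub_eq_zero.1 (mono_zero_mem_leftNucleus (by omega) x (mono σ m a 0 y) u)).symm
  have hK : ∀ x, ∀ u ∈ N, mono σ m a 0 x * u ∈ N := by
    intro x u hu
    induction hu using AddSubgroup.closure_induction with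
    | mem v hv =>
      obtain ⟨i, hi, y, rfl⟩ := hv
      rw [hassoc]
      exact hgen hi _
    | zero => simp
    | add v w _ _ hv hw => rw [mul_add]; exact N.add_mem hv hw
    | neg v _ hv => rw [mul_neg]; exact N.neg_mem hv
  have hrN : (T ^ r) h ∈ N := by
    have h1 : ∑ i ∈ Finset.range (r + 1), mono σ m a 0 (coeff i g) * (T ^ i) h = 0 := by
      rw [← hgh]
      conv_rhs => rw [← sum_mono_coeff g, Finset.sum_mul]
      rw [Finset.sum_subset (Finset.range_subset_range.2 (Nat.succ_le_of_lt hrm))]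
      · exact Finset.sum_congr rfl fun i hi => (mono_mul_eq hm (Finset.mem_range.1 hi) _ _).symm
      · intro i hi hi'
        rw [hmax i (Finset.mem_range.1 hi) (by simpa using hi'), map_zero, zero_mul]
    rw [Finset.sum_range_succ] at h1
    have h2 : mono σ m a 0 (coeff r g) * (T ^ r) h ∈ N := by
      rw [eq_neg_of_add_eq_zero_right h1]
      exact N.neg_mem (N.sum_mem fun i hi => hgen (Finset.mem_range.1 hi) _)
    have h3 := hK (coeff r g)⁻¹ _ h2
    rw [hassoc, inv_mul_cancel₀ hr] at h3
    rwa [← one_eq_mono, one_mul] at h3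
  have hT : ∀ u ∈ N, mono σ m a 1 1 * u ∈ N := by
    intro u hu
    induction hu using AddSubgroup.closure_induction with
    | mem v hv =>
      obtain ⟨i, hi, y, rfl⟩ := hv
      rw [mono_zero_mul_mono_one hm, ← LinearMap.mulLeft_apply (R := F) (a := mono σ m a 1 1),
        ← hTdef, ← Module.End.mul_apply, ← pow_succ']
      rcases Nat.lt_or_eq_of_le (Nat.succ_le_of_lt hi) with hi' | hi'
      · exact hgen hi' _
      · exact hK _ _ (by rw [← Nat.succ_eq_add_one, hi']; exact hrN)
    | zero => simp
    | add v w _ _ hv hw => rw [mul_add]; exact N.add_mem hv hw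
    | neg v _ hv => rw [mul_neg]; exact N.neg_mem hv
  have hN0 : N ≠ ⊥ := fun h0 => by
    rcases Nat.eq_zero_or_pos r with rfl | hr0
    · rw [h0, AddSubgroup.mem_bot] at hrN
      exact hh hrN
    · have := hgen hr0 1
      rw [← one_eq_mono, one_mul, h0, AddSubgroup.mem_bot] at this
      exact hh this
  have htop := eq_top_of_mul_mem hm hσ ha N hK hT hN0
  have hle : N ≤ (AddMonoidHom.mulRight h).range := by
    rw [hN, AddSubgroup.closure_le]
    rintro v ⟨i, hi, x, rfl⟩
    exact ⟨mono σ m a i x, mono_mul_eq hm (by omega) x h⟩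
  have hsurj : Function.Surjective (AddMonoidHom.mulRight h) :=
    AddMonoidHom.range_eq_top.1 (top_le_iff.1 (htop ▸ hle))
  have hinj := Finite.injective_iff_surjective.2 hsurj
  exact hg (hinj (by simpa using hgh))

theorem isDivision [Finite K] (hm : 1 < m) (hσ : σ ^ m = 1)
    (ha : ∀ i < m, ∀ j < m, i ≠ j → (σ ^ i) a ≠ (σ ^ j) a) :
    IsDivision (PetitAlgebra σ m a) := by
  have : Finite (PetitAlgebra σ m a) := Finite.of_injective _ (coeffEquiv σ m a).injective
  refine ⟨⟨0, 1, fun h => ?_⟩, fun x hx => ⟨?_, ?_⟩⟩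
  · rw [one_eq_mono, eq_comm, mono_eq_zero_iff (by omega)] at h
    exact one_ne_zero h
  · refine Finite.injective_iff_bijective.1
      ((injective_iff_map_eq_zero (AddMonoidHom.mulLeft x)).2 fun y hy => ?_)
    exact (eq_zero_or_eq_zero_of_mul_eq_zero hm hσ ha hy).resolve_left hx
  · refine Finite.injective_iff_bijective.1
      ((injective_iff_map_eq_zero (AddMonoidHom.mulRight x)).2 fun y hy => ?_)
    exact (eq_zero_or_eq_zero_of_mul_eq_zero hm hσ ha hy).resolve_right hx

/-- If `a = b σ(b) ⋯ σ^(m-1)(b)`, then `t - b` divides `t^m - a`, and the cofactor is a left zero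
divisor of the Petit algebra. -/
theorem not_isDivision_of_prod_eq (hm : 1 < m) {b : K}
    (hb : ∏ j ∈ Finset.range m, (σ ^ j) b = a) : ¬ IsDivision (PetitAlgebra σ m a) := by
  intro hdiv
  set d : ℕ → K := fun i => ∏ j ∈ Finset.Ico i m, (σ ^ j) b with hd
  set g : PetitAlgebra σ m a := ∑ i ∈ Finset.range m, mono σ m a i (d (i + 1)) with hg
  set h : PetitAlgebra σ m a := mono σ m a 1 1 - mono σ m a 0 b with hh
  have h0 : h ≠ 0 := fun h0 => by
    have := congrArg (coeff 1) h0
    rw [hh, map_sub, coeff_mono_self hm, coeff_mono (by omega), if_neg (by omega), sub_zero,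
      map_zero] at this
    exact one_ne_zero this
  have hg0 : g ≠ 0 := fun h0 => by
    have := congrArg (coeff (m - 1)) h0
    rw [hg, coeff_sum_mono (by omega), map_zero, hd] at this
    simp [Nat.sub_add_cancel hm.le] at this
  have hgh : g * h = 0 := by
    have (i : ℕ) (hi : i ∈ Finset.range m) : mono σ m a i (d (i + 1)) * h =
        mono σ m a (i + 1) (d (i + 1)) - mono σ m a i (d i) := by
      have hi := Finset.mem_range.1 hi
      rw [hh, mul_sub, mono_mul_mono hi hm, mono_mul_mono hi (by omega), map_one, mul_one, add_zero,
        mul_comm (d (i + 1))]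
      congr 2
      exact (Finset.prod_eq_prod_Ico_succ_bot hi fun j => (σ ^ j) b).symm
    rw [hg, Finset.sum_mul, Finset.sum_congr rfl this,
      Finset.sum_range_sub (fun i => mono σ m a i (d i)), mono_degree, sub_eq_zero]
    congr 1
    rw [hd]
    simp only [Finset.Ico_self, Finset.prod_empty, one_mul, ← Finset.range_eq_Ico, hb]
  exact h0 (((hdiv.2 g hg0).1.1 (hgh.trans (mul_zero g).symm)))

end PetitAlgebra
end Petit

namespace Petit

/-! ### Isomorphisms between Petit algebras -/

theorem exists_pow_eq_of_zpowers_eq_top {G : Type*} [Group G] {g : G} {n : ℕ}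
    (hg : Subgroup.zpowers g = ⊤) (hn : orderOf g = n) (h0 : 0 < n) (x : G) :
    ∃ i < n, g ^ i = x := by
  subst hn
  have hx : x ∈ Subgroup.zpowers g := hg ▸ Subgroup.mem_top x
  classical
  rw [(orderOf_pos_iff.1 h0).mem_zpowers_iff_mem_range_orderOf] at hx
  simpa using hx

namespace PetitAlgebra

section Construction

variable {F L K : Type u} [Field F] [Field L] [Field K] [Algebra F L] [Algebra F K]

/-- The twisted power `σ^(i-1)(k) ⋯ σ(k) k`, the coefficient of `(k t)^i` in `K[t;σ]`. -/
def twistedPow (σ : K ≃ₐ[F] K) (k : K) (i : ℕ) : K := ∏ j ∈ Finset.range i, (σ ^ j) k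

theorem twistedPow_add (σ : K ≃ₐ[F] K) (k : K) (i j : ℕ) :
    twistedPow σ k (i + j) = twistedPow σ k i * (σ ^ i) (twistedPow σ k j) := by
  rw [twistedPow, Finset.prod_range_add, twistedPow, twistedPow, map_prod]
  simp only [pow_add, AlgEquiv.mul_apply]

theorem twistedPow_one (σ : K ≃ₐ[F] K) (k : K) : twistedPow σ k 1 = k := by
  simp [twistedPow]

theorem twistedPow_ne_zero (σ : K ≃ₐ[F] K) {k : K} (hk : k ≠ 0) (i : ℕ) : twistedPow σ k i ≠ 0 :=
  Finset.prod_ne_zero_iff.2 fun j _ => (map_ne_zero_iff _ (σ ^ j).injective).2 hk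

/-- The isomorphism `Σ x_i t^i ↦ Σ ψ(x_i) (k t)^i` of Petit algebras. -/
theorem iso_of_twistedPow (ψ : L ≃ₐ[F] K) {σ : L ≃ₐ[F] L} {σ' : K ≃ₐ[F] K}
    (hψ : ∀ x, ψ (σ x) = σ' (ψ x)) {k : K} (hk : k ≠ 0) {m : ℕ} {a : L} {a' : K}
    (ha : ψ a = twistedPow σ' k m * a') : Iso F (PetitAlgebra σ m a) (PetitAlgebra σ' m a') := by
  have hψ' (i : ℕ) (x : L) : ψ ((σ ^ i) x) = (σ' ^ i) (ψ x) := by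
    induction i with
    | zero => rfl
    | succ i ih => rw [pow_succ', AlgEquiv.mul_apply, hψ, ih, pow_succ', AlgEquiv.mul_apply]
  let e : PetitAlgebra σ m a ≃ₗ[F] PetitAlgebra σ' m a' :=
    coeffEquiv σ m a ≪≫ₗ (LinearEquiv.piCongrRight fun i : Fin m => ψ.toLinearEquiv ≪≫ₗ
      DistribMulAction.toLinearEquiv F K (Units.mk0 _ (twistedPow_ne_zero σ' hk i))) ≪≫ₗ
      (coeffEquiv σ' m a').symm
  have hcoeff (i : ℕ) (hi : i < m) (g) : coeff i (e g) = twistedPow σ' k i * ψ (coeff i g) := by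
    have : coeffEquiv σ' m a' (e g) ⟨i, hi⟩ = twistedPow σ' k i * ψ (coeff i g) := by
      simp only [e, LinearEquiv.trans_apply, LinearEquiv.apply_symm_apply]
      rfl
    exact this
  have hmono' (i : ℕ) (hi : i < m) (x : L) :
      e (mono σ m a i x) = mono σ' m a' i (twistedPow σ' k i * ψ x) := by
    refine ext_coeff fun j hj => ?_
    rw [hcoeff j hj, coeff_mono hi, coeff_mono hi]
    split_ifs with h
    · rw [h]
    · simp
  have hmono (i : ℕ) (x : L) :
      e (mono σ m a i x) = mono σ' m a' i (twistedPow σ' k i * ψ x) := by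
    rcases Nat.eq_zero_or_pos m with rfl | hm
    · exact eq_of_zero _ _
    induction i using Nat.strong_induction_on generalizing x with
    | _ i ih =>
      by_cases hi : i < m
      · exact hmono' i hi x
      · obtain ⟨j, rfl⟩ := Nat.exists_eq_add_of_le' (not_lt.1 hi)
        rw [mono_add_degree, ih j (by omega), mono_add_degree, map_mul ψ, hψ', ha,
          twistedPow_add, map_mul (σ' ^ j)]
        congr 1
        ring
  refine ⟨e, map_mul_of_mono e.toLinearMap fun i hi j hj x y => ?_⟩
  change e _ = e _ * e _
  rw [mono_mul_mono hi hj, hmono, hmono, hmono, mono_mul_mono hi hj, twistedPow_add, map_mul ψ,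
    map_mul (σ' ^ i), hψ']
  congr 1
  ring

end Construction

section Rigidity

variable {F K : Type u} [Field F] [Field K] [Algebra F K] {σ σ' : K ≃ₐ[F] K} {m : ℕ} {a a' : K}

/-- An element `u` with `u x = ρ(x) u` for all `x ∈ K` is supported in the degrees `i` with
`σ^i = ρ`. -/
theorem coeff_eq_zero_of_mul_mono_zero {ρ : K ≃ₐ[F] K} {u : PetitAlgebra σ m a}
    (hu : ∀ x, u * mono σ m a 0 x = mono σ m a 0 (ρ x) * u) {i : ℕ} (hi : σ ^ i ≠ ρ) :
    coeff i u = 0 := by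
  by_contra hc
  refine hi (AlgEquiv.ext fun x => ?_)
  have h := congrArg (coeff i) (hu x)
  rw [mul_mono_zero, mono_zero_mul, mul_comm] at h
  exact mul_right_cancel₀ hc h

theorem eq_mono_of_mul_mono_zero (hm : orderOf σ = m) {i : ℕ} (hi : i < m)
    {u : PetitAlgebra σ m a}
    (hu : ∀ x, u * mono σ m a 0 x = mono σ m a 0 ((σ ^ i) x) * u) :
    u = mono σ m a i (coeff i u) := by
  refine ext_coeff fun j hj => ?_
  rw [coeff_mono hi]
  split_ifs with h
  · rw [h]
  · refine coeff_eq_zero_of_mul_mono_zero hu fun h' => h ?_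
    subst hm
    exact (pow_injOn_Iio_orderOf hj hi h').symm

theorem associator_mono_one_mono (hm : 1 < m) {j : ℕ} (hj : j + 1 < m) (c : K)
    (z : PetitAlgebra σ m a) : associator (mono σ m a 1 1) (mono σ m a j c) z = 0 := by
  rw [associator_apply, mono_mul_mono hm (by omega), sub_eq_zero]
  induction z using mono_induction with
  | zero => simp
  | add g h hg hh => rw [mul_add, mul_add, mul_add, hg, hh]
  | mono l hl x =>
    rw [mono_mul_mono (by omega) hl, mono_mul_mono (by omega) hl, mono_mul_mono' hm, one_mul,
      one_mul, pow_add, AlgEquiv.mul_apply, map_mul (σ ^ 1), add_assoc]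

theorem mono_mul_mono_zero_comm {i : ℕ} (hi : i < m) (x y : K) :
    mono σ m a i y * mono σ m a 0 x = mono σ m a 0 ((σ ^ i) x) * mono σ m a i y := by
  rw [mono_mul_mono hi (by omega), mono_mul_mono (by omega) hi, add_zero, zero_add, mul_comm]
  rfl

/-- Isomorphic Petit algebras of degree `m = [K:F]` whose constants are not fixed come from the same
automorphism `σ`, and their constants agree up to the action of an automorphism and a norm.

An isomorphism `e` restricts to an automorphism of the left nucleus `K`, and `e(t)` acts on `K` by
conjugation as `t` does, so `e(t) = k t^i` with `σ'^i = σ`. Associators `[t, t^j, z]` vanish for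
`j + 1 < m`, whereas `[t^i, t^(m-i+1), t]` does not for `i > 1`. -/
theorem eq_and_exists_of_iso (hm : 1 < m) (hσ : Subgroup.zpowers σ = ⊤)
    (hσ' : Subgroup.zpowers σ' = ⊤) (hord : orderOf σ = m) (hord' : orderOf σ' = m) (ha : σ a ≠ a)
    (ha' : σ' a' ≠ a')
    [FiniteDimensional F K] (h : Iso F (PetitAlgebra σ m a) (PetitAlgebra σ' m a')) :
    σ = σ' ∧ ∃ (τ : K ≃ₐ[F] K) (k : K), k ≠ 0 ∧ τ a = twistedPow σ' k m * a' := by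
  obtain ⟨e, he⟩ := h
  have hm0 : 0 < m := by omega
  have hpow := exists_pow_eq_of_zpowers_eq_top hσ' hord' hm0
  have hcomm (ρ ρ' : K ≃ₐ[F] K) : ρ * ρ' = ρ' * ρ := by
    obtain ⟨i, -, rfl⟩ := hpow ρ
    obtain ⟨j, -, rfl⟩ := hpow ρ'
    rw [← pow_add, ← pow_add, add_comm]
  -- the restriction of `e` to the left nuclei
  have hleft (x : K) : ∃ y, e (mono σ m a 0 x) = mono σ' m a' 0 y := by
    refine ⟨_, eq_mono_zero_of_mem_leftNucleus hm ha' fun y z => ?_⟩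
    have h := congrArg e (mono_zero_mem_leftNucleus hm0 x (e.symm y) (e.symm z))
    simpa [associator_apply, he] using h
  obtain ⟨τ, hτ⟩ : ∃ τ : K ≃ₐ[F] K, ∀ x, e (mono σ m a 0 x) = mono σ' m a' 0 (τ x) := by
    let f : K →ₗ[F] K := coeff 0 ∘ₗ e.toLinearMap ∘ₗ mono σ m a 0
    have hf (x : K) : e (mono σ m a 0 x) = mono σ' m a' 0 (f x) := by
      obtain ⟨y, hy⟩ := hleft x
      change _ = mono σ' m a' 0 (coeff 0 (e (mono σ m a 0 x)))
      rw [hy, coeff_mono_self hm0]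
    have he1 : e (1 : PetitAlgebra σ m a) = 1 := by
      have := he (e.symm 1) 1
      rwa [mul_one, e.apply_symm_apply, one_mul, eq_comm] at this
    let φ : K →ₐ[F] K := AlgHom.ofLinearMap f
      (mono_injective hm0 (by rw [← hf, ← one_eq_mono, he1, ← one_eq_mono])) fun x y =>
      mono_injective hm0 (by
        rw [← hf, ← mono_zero_mul_mono_zero hm0, he, hf, hf, mono_zero_mul_mono_zero hm0])
    exact ⟨AlgEquiv.ofBijective φ (Algebra.IsAlgebraic.algHom_bijective φ), hf⟩
  have hτcomm (ρ : K ≃ₐ[F] K) (x : K) : τ (ρ x) = ρ (τ x) := by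
    rw [← AlgEquiv.mul_apply, hcomm, AlgEquiv.mul_apply]
  obtain ⟨i, him, hi⟩ := hpow σ
  obtain ⟨k, hk⟩ : ∃ k, e (mono σ m a 1 1) = mono σ' m a' i k := by
    refine ⟨_, eq_mono_of_mul_mono_zero hord' him fun x => ?_⟩
    obtain ⟨x, rfl⟩ := τ.surjective x
    rw [← hτ, ← he, mono_mul_mono_zero_comm hm, pow_one, he, hτ, hi, hτcomm]
  have hk0 : k ≠ 0 := by
    rintro rfl
    rw [map_zero, ← map_zero e] at hk
    exact one_ne_zero ((mono_eq_zero_iff hm).1 (e.injective hk))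
  -- for `i > 1`, the preimage of `t^(m-i+1)` is some `c t^j` with `j + 1 < m`, so the associator
  -- `[t^i, t^(m-i+1), t]` would vanish
  have hi1 : i = 1 := by
    by_contra hi1
    have hi0 : i ≠ 0 := by
      rintro rfl
      rw [← hi] at ha
      exact ha rfl
    obtain ⟨j, hjm, hj⟩ : ∃ j < m, σ ^ j = σ' ^ (m - i + 1) :=
      exists_pow_eq_of_zpowers_eq_top hσ hord hm0 _
    have hj1 : j + 1 < m := by
      by_contra hjm'
      have h1 : σ' ^ (m - i + 1 + i) = 1 := by
        rw [pow_add, ← hj, hi, ← pow_succ, show j + 1 = m by omega, ← hord, pow_orderOf_eq_one]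
      rw [show m - i + 1 + i = m + 1 by omega, pow_succ, ← hord', pow_orderOf_eq_one,
        one_mul] at h1
      exact ha' (by rw [h1, AlgEquiv.one_apply])
    obtain ⟨c, hc⟩ : ∃ c, e.symm (mono σ' m a' (m - i + 1) 1) = mono σ m a j c := by
      refine ⟨_, eq_mono_of_mul_mono_zero hord hjm fun x => ?_⟩
      apply e.injective
      rw [he, he, hτ, hτ, e.apply_symm_apply, mono_mul_mono_zero_comm (by omega), hj, hτcomm]
    have h := congrArg e (associator_mono_one_mono hm hj1 c (e.symm (mono σ' m a' 1 1)))
    rw [associator_apply, map_sub, he, he, he, he, hk, ← hc, e.apply_symm_apply,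
      e.apply_symm_apply, map_zero, sub_eq_zero, mono_mul_mono him (by omega),
      show i + (m - i + 1) = 1 + m by omega, mono_add_degree, mono_mul_mono hm hm,
      mono_mul_mono (by omega) hm, mono_mul_mono' him,
      show i + (m - i + 1 + 1) = 1 + 1 + m by omega, mono_add_degree] at h
    have h2 := mono_injective (by omega) h
    simp only [map_one, mul_one, pow_one] at h2
    have h3 := mul_left_cancel₀ hk0 h2
    rw [pow_add, pow_one, AlgEquiv.mul_apply] at h3
    exact ha' (σ'.injective h3).symm
  subst hi1
  rw [pow_one] at hi
  refine ⟨hi.symm, τ, k, hk0, ?_⟩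
  subst hi
  have hpowt (j : ℕ) (hj : j < m) : e (mono σ' m a j 1) = mono σ' m a' j (twistedPow σ' k j) := by
    induction j with
    | zero => exact (hτ 1).trans (by rw [map_one]; rfl)
    | succ j ih =>
      have h1 : mono σ' m a (j + 1) 1 = mono σ' m a 1 1 * mono σ' m a j 1 := by
        rw [mono_mul_mono hm (by omega), map_one (σ' ^ 1), mul_one, add_comm]
      rw [h1, he, hk, ih (by omega), mono_mul_mono hm (by omega), add_comm j 1, twistedPow_add,
        twistedPow_one]
  have h := he (mono σ' m a 1 1) (mono σ' m a (m - 1) 1)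
  rw [hk, hpowt _ (by omega), mono_mul_mono hm (by omega), mono_mul_mono hm (by omega), map_one,
    mul_one, show 1 + (m - 1) = m by omega, mono_degree, mono_degree, one_mul, hτ] at h
  have h2 := mono_injective hm0 h
  rw [h2]
  conv_rhs => rw [show m = 1 + (m - 1) by omega, twistedPow_add, twistedPow_one]

end Rigidity

end PetitAlgebra
end Petit

namespace Petit

/-! ### Cyclic extensions of finite fields -/

section FiniteField

variable {F K : Type u} [Field F] [Field K] [Algebra F K]

theorem orderOf_eq_finrank [FiniteDimensional F K] [IsGalois F K] {σ : K ≃ₐ[F] K}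
    (hσ : Subgroup.zpowers σ = ⊤) : orderOf σ = Module.finrank F K := by
  rw [orderOf_eq_card_of_zpowers_eq_top hσ, IsGalois.card_aut_eq_finrank]

theorem mem_range_algebraMap_of_fixed [FiniteDimensional F K] [IsGalois F K] {σ : K ≃ₐ[F] K}
    (hσ : Subgroup.zpowers σ = ⊤) {x : K} (hx : σ x = x) : x ∈ Set.range (algebraMap F K) := by
  rw [← IntermediateField.mem_bot, IsGalois.mem_bot_iff_fixed]
  intro f
  obtain ⟨i, -, rfl⟩ := exists_pow_eq_of_zpowers_eq_top hσ rfl (orderOf_pos σ) f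
  induction i with
  | zero => rfl
  | succ i ih => rw [pow_succ, AlgEquiv.mul_apply, hx, ih]

theorem twistedPow_finrank [FiniteDimensional F K] [IsGalois F K] {σ : K ≃ₐ[F] K}
    (hσ : Subgroup.zpowers σ = ⊤) (k : K) :
    PetitAlgebra.twistedPow σ k (Module.finrank F K) = algebraMap F K (Algebra.norm F k) := by
  rw [Algebra.norm_eq_prod_automorphisms, PetitAlgebra.twistedPow, ← orderOf_eq_finrank hσ]
  refine Finset.prod_bij (fun i _ => σ ^ i) (fun _ _ => Finset.mem_univ _) (fun i hi j hj h => ?_)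
    (fun ρ _ => ?_) fun _ _ => rfl
  · exact pow_injOn_Iio_orderOf (Finset.mem_range.1 hi) (Finset.mem_range.1 hj) h
  · obtain ⟨i, hi, h⟩ := exists_pow_eq_of_zpowers_eq_top hσ rfl (orderOf_pos σ) ρ
    exact ⟨i, Finset.mem_range.2 hi, h⟩

theorem pow_apply_ne_of_prime [FiniteDimensional F K] [IsGalois F K]
    (hp : (Module.finrank F K).Prime) {σ : K ≃ₐ[F] K} (hσ : Subgroup.zpowers σ = ⊤) {a : K}
    (ha : a ∉ Set.range (algebraMap F K)) {i j : ℕ} (hi : i < Module.finrank F K)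
    (hj : j < Module.finrank F K) (hij : i ≠ j) : (σ ^ i) a ≠ (σ ^ j) a := by
  have key {i j : ℕ} (hj : j < Module.finrank F K) (hij : i < j) : (σ ^ i) a ≠ (σ ^ j) a := by
    intro h
    obtain ⟨k, rfl⟩ := Nat.exists_eq_add_of_lt hij
    rw [add_assoc, pow_add, AlgEquiv.mul_apply] at h
    have h1 := ((σ ^ i).injective h).symm
    refine ha (mem_range_algebraMap_of_fixed ?_ h1)
    have : Fact (Module.finrank F K).Prime := ⟨hp⟩
    refine zpowers_eq_top_of_prime_card (IsGalois.card_aut_eq_finrank F K) fun h2 => ?_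
    have := orderOf_dvd_of_pow_eq_one h2
    rw [orderOf_eq_finrank hσ] at this
    exact absurd (Nat.le_of_dvd (by omega) this) (by omega)
  rcases lt_or_gt_of_ne hij with h | h
  · exact key hj h
  · exact (key hi h).symm

/-- A generator of the unit group of a finite field has distinct conjugates. -/
theorem exists_forall_apply_injective [Finite K] :
    ∃ a : K, Function.Injective fun ρ : K ≃ₐ[F] K => ρ a := by
  obtain ⟨g, hg⟩ := IsCyclic.exists_generator (α := Kˣ)
  refine ⟨g, fun ρ ρ' h => AlgEquiv.ext fun x => ?_⟩
  rcases eq_or_ne x 0 with rfl | hx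
  · simp
  · obtain ⟨i, hi⟩ := hg (Units.mk0 x hx)
    have hi := congrArg Units.val hi
    simp only [Units.val_zpow_eq_zpow_val, Units.val_mk0] at hi
    rw [← hi, map_zpow₀, map_zpow₀]
    exact congrArg (· ^ i) h

/-- The Galois group is cyclic of order `[K:F]`. -/
theorem card_generators_eq_totient [Finite F] [FiniteDimensional F K] :
    Nat.card {σ : K ≃ₐ[F] K // Subgroup.zpowers σ = ⊤} = Nat.totient (Module.finrank F K) := by
  classical
  have : Finite K := Module.finite_of_finite F
  have : Fintype (K ≃ₐ[F] K) := Fintype.ofFinite _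
  have hcard : Fintype.card (K ≃ₐ[F] K) = Module.finrank F K := by
    rw [← Nat.card_eq_fintype_card, IsGalois.card_aut_eq_finrank]
  rw [← IsCyclic.card_orderOf_eq_totient (α := K ≃ₐ[F] K) (dvd_of_eq hcard.symm),
    Nat.card_eq_fintype_card, Fintype.card_subtype]
  congr 1
  ext σ
  simp only [Finset.mem_filter, Finset.mem_univ, true_and]
  refine ⟨orderOf_eq_finrank, fun h => Subgroup.eq_top_of_card_eq _ ?_⟩
  rw [Nat.card_zpowers, h, IsGalois.card_aut_eq_finrank]

/-- The minimal polynomial of `τ` as an `F`-linear map is `X^n - 1` with `n` the order of `τ`, so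
every `n`-th root of unity in `F` is an eigenvalue. -/
theorem exists_eigenvector [FiniteDimensional F K] [IsGalois F K] {τ : K ≃ₐ[F] K} {c : F}
    (hc : c ^ orderOf τ = 1) : ∃ y : K, y ≠ 0 ∧ τ y = algebraMap F K c * y := by
  have hroot : (minpoly F τ.toLinearMap).IsRoot c := by
    rw [minpoly_algEquiv_toLinearMap τ (isOfFinOrder_of_finite τ)]
    simp [hc]
  obtain ⟨y, hy⟩ := (Module.End.hasEigenvalue_of_isRoot hroot).exists_hasEigenvector
  exact ⟨y, hy.2, by simpa [Algebra.smul_def] using hy.apply_eq_smul⟩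

end FiniteField

/-! ### Opposite algebras -/

section Opposite

open MulOpposite

variable {F K A : Type u} [Field F] [Field K] [Algebra F K] [NonAssocRing A] [Module F A]

theorem mem_leftNucleus_op {x : Aᵐᵒᵖ} : x ∈ leftNucleus Aᵐᵒᵖ ↔ unop x ∈ rightNucleus A := by
  simp only [leftNucleus, rightNucleus, Set.mem_ofPred_eq, associator_op, neg_eq_zero,
    op_eq_zero_iff]
  exact ⟨fun h y z => h (op z) (op y), fun h y z => h _ _⟩

theorem mem_middleNucleus_op {x : Aᵐᵒᵖ} : x ∈ middleNucleus Aᵐᵒᵖ ↔ unop x ∈ middleNucleus A := by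
  simp only [middleNucleus, Set.mem_ofPred_eq, associator_op, neg_eq_zero,
    op_eq_zero_iff]
  exact ⟨fun h y z => h (op z) (op y), fun h y z => h _ _⟩

theorem mem_rightNucleus_op {x : Aᵐᵒᵖ} : x ∈ rightNucleus Aᵐᵒᵖ ↔ unop x ∈ leftNucleus A := by
  simp only [leftNucleus, rightNucleus, Set.mem_ofPred_eq, associator_op, neg_eq_zero,
    op_eq_zero_iff]
  exact ⟨fun h y z => h (op z) (op y), fun h y z => h _ _⟩

theorem IsCopyOf.op {S : Set A} (h : IsCopyOf F K S) : IsCopyOf F K (unop ⁻¹' S) := by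
  obtain ⟨f, h1, hmul, hinj, rfl⟩ := h
  refine ⟨(opLinearEquiv F).toLinearMap ∘ₗ f, ?_, fun x y => ?_, ?_, ?_⟩
  · simp [h1]
  · simp [mul_comm x y, hmul]
  · exact (opLinearEquiv F).injective.comp hinj
  · ext x
    exact ⟨fun ⟨y, hy⟩ => ⟨y, by rw [← hy]; rfl⟩,
      fun ⟨y, hy⟩ => ⟨y, unop_injective (by rw [← hy]; rfl)⟩⟩

theorem IsDivision.op (h : IsDivision A) : IsDivision Aᵐᵒᵖ := by
  obtain ⟨hn, h⟩ := h
  refine ⟨inferInstance, fun x hx => ?_⟩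
  obtain ⟨h1, h2⟩ := h (unop x) (by simpa using hx)
  exact ⟨(opEquiv.bijective.comp h2).comp opEquiv.symm.bijective,
    (opEquiv.bijective.comp h1).comp opEquiv.symm.bijective⟩

theorem IsDivision.of_op_iso {B : Type u} [NonAssocRing B] [Module F B] (h : IsDivision A)
    (e : Iso F A Bᵐᵒᵖ) : IsDivision B := by
  obtain ⟨e, he⟩ := e
  obtain ⟨hn, h⟩ := h
  let E : A ≃ B := e.toEquiv.trans opEquiv.symm
  have hE (x y) : E (x * y) = E y * E x := congrArg unop (he x y)
  refine ⟨E.symm.nontrivial, fun x hx => ?_⟩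
  obtain ⟨h1, h2⟩ := h (E.symm x) (fun h0 => hx (by
    rw [← E.apply_symm_apply x, h0]; exact congrArg unop (map_zero e)))
  constructor
  · convert (E.bijective.comp h2).comp E.symm.bijective using 1
    ext y
    simp [hE]
  · convert (E.bijective.comp h1).comp E.symm.bijective using 1
    ext y
    simp [hE]

theorem Iso.op {B : Type u} [NonAssocRing B] [Module F B] (h : Iso F A B) : Iso F Aᵐᵒᵖ Bᵐᵒᵖ := by
  obtain ⟨e, he⟩ := h
  exact ⟨(opLinearEquiv F).symm ≪≫ₗ e ≪≫ₗ opLinearEquiv F, fun x y => by simp [he]⟩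

theorem Iso.of_op {B : Type u} [NonAssocRing B] [Module F B] (h : Iso F Aᵐᵒᵖ Bᵐᵒᵖ) :
    Iso F A B := by
  obtain ⟨e, he⟩ := h
  exact ⟨opLinearEquiv F ≪≫ₗ e ≪≫ₗ (opLinearEquiv F).symm, fun x y => by simp [he]⟩

end Opposite

end Petit

namespace Petit

open MulOpposite PetitAlgebra

variable {F K : Type u} [Field F] [Field K] [Algebra F K]

/-! ### Cyclic algebras over finite fields -/

section Cyclic

variable [Finite F] [FiniteDimensional F K]

theorem apply_ne_self {σ : K ≃ₐ[F] K} (hσ : Subgroup.zpowers σ = ⊤) {a : K}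
    (ha : a ∉ Set.range (algebraMap F K)) : σ a ≠ a :=
  have := Module.finite_of_finite F (M := K)
  fun h => ha (mem_range_algebraMap_of_fixed hσ h)

/-- If `(K/F,σ,a)` is a division algebra, then `a` is not in `F`, since every element of `F` is a
norm. -/
theorem notMem_range_of_isDivision (hm : 1 < Module.finrank F K) {σ : K ≃ₐ[F] K}
    (hσ : Subgroup.zpowers σ = ⊤) {a : K} (h : IsDivision (CyclicAlgebra σ a)) :
    a ∉ Set.range (algebraMap F K) := by
  have := Module.finite_of_finite F (M := K)
  rintro ⟨c, rfl⟩
  obtain ⟨b, rfl⟩ := FiniteField.norm_surjective F K c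
  exact not_isDivision_of_prod_eq hm (twistedPow_finrank hσ b) h

theorem isSemifield_of_injOn (hm : 1 < Module.finrank F K) {σ : K ≃ₐ[F] K}
    (hσ : Subgroup.zpowers σ = ⊤) {a : K} (ha : ∀ i < Module.finrank F K,
      ∀ j < Module.finrank F K, i ≠ j → (σ ^ i) a ≠ (σ ^ j) a) :
    IsSemifield F (CyclicAlgebra σ a) := by
  have := Module.finite_of_finite F (M := K)
  exact ⟨inferInstance, inferInstance,
    isDivision hm (by rw [← orderOf_eq_finrank hσ, pow_orderOf_eq_one]) ha⟩

theorem exists_isSemifield (hm : 1 < Module.finrank F K) {σ : K ≃ₐ[F] K}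
    (hσ : Subgroup.zpowers σ = ⊤) : ∃ a : K, IsSemifield F (CyclicAlgebra σ a) := by
  have := Module.finite_of_finite F (M := K)
  obtain ⟨a, ha⟩ := exists_forall_apply_injective (F := F) (K := K)
  refine ⟨a, isSemifield_of_injOn hm hσ fun i hi j hj hij h => hij ?_⟩
  rw [← orderOf_eq_finrank hσ] at hi hj
  exact pow_injOn_Iio_orderOf hi hj (ha h)

/-- Cyclic algebras `(K/F,σ,a)` and `(K/F,σ',a')` with `a, a' ∉ F` are isomorphic if and only if
`σ = σ'` and `a`, `a'` are in the same orbit of `Gal(K/F) × Fˣ`. -/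
theorem iso_cyclicAlgebra_iff (hm : 1 < Module.finrank F K) {σ σ' : K ≃ₐ[F] K}
    (hσ : Subgroup.zpowers σ = ⊤) (hσ' : Subgroup.zpowers σ' = ⊤) {a a' : K}
    (ha : a ∉ Set.range (algebraMap F K)) (ha' : a' ∉ Set.range (algebraMap F K)) :
    Iso F (CyclicAlgebra σ a) (CyclicAlgebra σ' a') ↔
      σ = σ' ∧ ∃ (τ : K ≃ₐ[F] K) (c : Fˣ), (c : F) • τ a' = a := by
  have := Module.finite_of_finite F (M := K)
  constructor
  · intro h
    obtain ⟨rfl, τ, k, hk, h⟩ := eq_and_exists_of_iso hm hσ hσ' (orderOf_eq_finrank hσ)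
      (orderOf_eq_finrank hσ') (apply_ne_self hσ ha) (apply_ne_self hσ' ha') h
    refine ⟨rfl, τ.symm, Units.mk0 _ (Algebra.norm_ne_zero_iff.2 hk), τ.injective ?_⟩
    rw [h, twistedPow_finrank hσ, map_smul, AlgEquiv.apply_symm_apply, Algebra.smul_def]
    rfl
  · rintro ⟨rfl, τ, c, h⟩
    obtain ⟨k, hk⟩ := FiniteField.norm_surjective F K c
    have hk0 : k ≠ 0 := Algebra.norm_ne_zero_iff.1 (hk ▸ c.ne_zero)
    refine iso_of_twistedPow τ.symm (fun x => ?_) hk0 ?_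
    · have hcomm : τ.symm * σ = σ * τ.symm := by
        obtain ⟨i, -, hi⟩ := exists_pow_eq_of_zpowers_eq_top hσ rfl (orderOf_pos σ) τ.symm
        rw [← hi, ← pow_succ, ← pow_succ']
      exact DFunLike.congr_fun hcomm x
    · rw [twistedPow_finrank hσ, hk, ← Algebra.smul_def, ← h, map_smul, AlgEquiv.symm_apply_apply]

end Cyclic

/-! ### Sandler semifields with prescribed nuclei -/

section Sandler

variable [Finite F]

/-- For `m = [K:F]` prime and `a ∉ F`, the opposite algebra of `(K/F,σ,a)` is a Sandler semifield of
order `q^(m^2)` with center `F` and nuclei `K`. -/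
def sandlerSemifield (hp : (Module.finrank F K).Prime) {σ : K ≃ₐ[F] K}
    (hσ : Subgroup.zpowers σ = ⊤) {a : K} (ha : a ∉ Set.range (algebraMap F K)) :
    SandlerSemifield F K (Nat.card F ^ Module.finrank F K ^ 2) :=
  have hFD : FiniteDimensional F K := Module.finite_of_finrank_pos hp.pos
  have hK : Finite K := Module.finite_of_finite F
  have hne (i) (hi : i < Module.finrank F K) (j) (hj : j < Module.finrank F K) (hij : i ≠ j) :
      (σ ^ i) a ≠ (σ ^ j) a := pow_apply_ne_of_prime hp hσ ha hi hj hij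
  have hσm : σ ^ Module.finrank F K = 1 := by rw [← orderOf_eq_finrank hσ, pow_orderOf_eq_one]
  have hσa : σ a ≠ a := apply_ne_self hσ ha
  have hfin : Module.Finite F (CyclicAlgebra σ a)ᵐᵒᵖ := Module.Finite.equiv (opLinearEquiv F)
  { carrier := (CyclicAlgebra σ a)ᵐᵒᵖ
    isSandler := by
      refine ⟨⟨inferInstance, hfin, (isSemifield_of_injOn hp.one_lt hσ hne).2.2.op⟩, K,
        inferInstance, inferInstance, σ, _, a, hFD, inferInstance, hσ, hp.one_lt, le_rfl,
        Iso.refl⟩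
    card_eq := by
      rw [Module.natCard_eq_pow_finrank (K := F), ← (opLinearEquiv F).finrank_eq, finrank_eq, sq]
    center_eq := by
      ext x
      rw [← op_unop x, op_mem_center_iff,
        center_eq_range hp.one_lt hσa fun x hx => mem_range_algebraMap_of_fixed hσ hx]
      exact ⟨fun ⟨c, hc⟩ => ⟨c, congrArg op hc⟩, fun ⟨c, hc⟩ => ⟨c, congrArg unop hc⟩⟩
    leftNucleus_eq := by
      have h := (isCopyOf_range (σ := σ) (a := a) hp.pos).op
      rw [← rightNucleus_eq_range hp.one_lt hσm fun i hi h0 => hne i hi 0 hp.pos h0.ne'] at h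
      convert h using 1
      ext x
      exact mem_leftNucleus_op
    middleNucleus_eq := by
      have h := (isCopyOf_range (σ := σ) (a := a) hp.pos).op
      rw [← middleNucleus_eq_range hp.one_lt hσa] at h
      convert h using 1
      ext x
      exact mem_middleNucleus_op
    rightNucleus_eq := by
      have h := (isCopyOf_range (σ := σ) (a := a) hp.pos).op
      rw [← leftNucleus_eq_range hp.one_lt hσa] at h
      convert h using 1
      ext x
      exact mem_rightNucleus_op }

/-- Every Sandler semifield of order `q^(m^2)` with right nucleus `K`, `m = [K:F]`, is opposite to a
cyclic algebra `(K/F,σ,a)` with `a ∉ F`. If it is opposite to `L[t;σ]/L[t;σ](t^d - a)`, then `L`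
embeds into the right nucleus, so `d ≤ [L:F] ≤ m`, and `d [L:F] = m^2` forces equality. -/
theorem SandlerSemifield.exists_iso (hm : 1 < Module.finrank F K)
    (S : SandlerSemifield F K (Nat.card F ^ Module.finrank F K ^ 2)) :
    ∃ (σ : K ≃ₐ[F] K) (a : K), Subgroup.zpowers σ = ⊤ ∧ a ∉ Set.range (algebraMap F K) ∧
      Iso F S.carrier (CyclicAlgebra σ a)ᵐᵒᵖ := by
  have hFD : FiniteDimensional F K := Module.finite_of_finrank_pos (by omega)
  obtain ⟨⟨-, hfin, hdiv⟩, L, _, _, σ, d, a, hL, -, hσ, hd1, hdn, e, he⟩ := S.isSandler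
  have hcard := S.card_eq
  rw [Module.natCard_eq_pow_finrank (K := F)] at hcard
  have hfr := Nat.pow_right_injective (Finite.one_lt_card : 1 < Nat.card F) hcard
  rw [e.finrank_eq, ← (opLinearEquiv F).finrank_eq, finrank_eq] at hfr
  have hle : Module.finrank F L ≤ Module.finrank F K := by
    obtain ⟨f, -, -, hf, hfS⟩ := S.rightNucleus_eq
    let g : L →ₗ[F] S.carrier :=
      e.symm.toLinearMap ∘ₗ (opLinearEquiv F).toLinearMap ∘ₗ mono σ d a 0
    have hg : Function.Injective g :=
      e.symm.injective.comp ((opLinearEquiv F).injective.comp (mono_injective (by omega)))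
    refine (LinearMap.finrank_range_of_inj hg).ge.trans
      (le_trans (Submodule.finrank_mono ?_) (LinearMap.finrank_range_of_inj hf).le)
    rintro _ ⟨x, rfl⟩
    change g x ∈ Set.range f
    rw [hfS]
    intro y z
    apply e.injective
    have h : op (mono σ d a 0 x) ∈ rightNucleus (PetitAlgebra σ d a)ᵐᵒᵖ :=
      mem_rightNucleus_op.2 (mono_zero_mem_leftNucleus (by omega) x)
    have hgx : e (g x) = op (mono σ d a 0 x) := e.apply_symm_apply _
    have h := h (e y) (e z)
    rw [associator_apply, map_sub, he, he, he, he, hgx, map_zero, ← associator_apply, h]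
  obtain ⟨hnm, hdm⟩ : Module.finrank F L = Module.finrank F K ∧ d = Module.finrank F K := by
    constructor <;> nlinarith
  subst hdm
  obtain ⟨p, hchar⟩ := CharP.exists F
  have hprime : Fact p.Prime := ⟨(CharP.char_is_prime_or_zero F p).resolve_right
    (CharP.char_ne_zero_of_finite F p)⟩
  have : NeZero (Module.finrank F K) := ⟨by omega⟩
  let ψ : L ≃ₐ[F] K := (FiniteField.algEquivExtension F p (Module.finrank F K) L hnm).trans
    (FiniteField.algEquivExtension F p (Module.finrank F K) K rfl).symm
  have hσ' : Subgroup.zpowers (AlgEquiv.autCongr ψ σ) = ⊤ := by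
    have := MonoidHom.map_zpowers (AlgEquiv.autCongr ψ).toMonoidHom σ
    rw [hσ, Subgroup.map_top_of_surjective _ (AlgEquiv.autCongr ψ).surjective] at this
    exact this.symm
  have hiso : Iso F S.carrier (CyclicAlgebra (AlgEquiv.autCongr ψ σ) (ψ a))ᵐᵒᵖ := by
    refine Iso.trans ⟨e, he⟩ (Iso.op (iso_of_twistedPow ψ (fun x => ?_) one_ne_zero ?_))
    · simp
    · simp only [twistedPow, map_one, Finset.prod_const_one, one_mul]
  exact ⟨_, _, hσ', notMem_range_of_isDivision hm hσ' (hdiv.of_op_iso hiso), hiso⟩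

end Sandler

end Petit

namespace Petit

variable (F K : Type u) [Field F] [Field K] [Algebra F K]

/-! ### Counting orbits -/

/-- The set `K ∖ F`. -/
def NonBase : Type u := {a : K // a ∉ Set.range (algebraMap F K)}

variable {F K}

theorem smul_apply_notMem_range (τ : K ≃ₐ[F] K) (c : Fˣ) {a : K}
    (ha : a ∉ Set.range (algebraMap F K)) :
    (c : F) • τ a ∉ Set.range (algebraMap F K) := by
  rintro ⟨d, hd⟩
  refine ha ⟨(c : F)⁻¹ * d, τ.injective ?_⟩
  rw [AlgEquiv.commutes, map_mul, hd, ← Algebra.smul_def, inv_smul_smul₀ c.ne_zero]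

/-- The action of `Gal(K/F) × Fˣ` on `K ∖ F` by `(τ,c) a = c τ(a)`. -/
instance : MulAction ((K ≃ₐ[F] K) × Fˣ) (NonBase F K) where
  smul g a := ⟨(g.2 : F) • g.1 a.1, smul_apply_notMem_range g.1 g.2 a.2⟩
  one_smul a := Subtype.ext (one_smul F a.1)
  mul_smul g h a := Subtype.ext (by
    change ((g.2 * h.2 : Fˣ) : F) • (g.1 * h.1) a.1 = (g.2 : F) • g.1 ((h.2 : F) • h.1 a.1)
    rw [map_smul, smul_smul]
    rfl)

theorem NonBase.mem_fixedBy {g : (K ≃ₐ[F] K) × Fˣ} {a : NonBase F K} :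
    a ∈ MulAction.fixedBy (NonBase F K) g ↔ (g.2 : F) • g.1 a.1 = a.1 := by
  rw [MulAction.mem_fixedBy]
  exact Subtype.ext_iff

theorem NonBase.ne_zero (a : NonBase F K) : a.1 ≠ 0 := fun h => a.2 ⟨0, by rw [h, map_zero]⟩

theorem NonBase.card [Finite K] : Nat.card (NonBase F K) = Nat.card K - Nat.card F := by
  classical
  have h := Nat.card_congr (Equiv.Set.sumCompl (Set.range (algebraMap F K)))
  rw [Nat.card_sum, Nat.card_range_of_injective (algebraMap F K).injective] at h
  rw [← h, Nat.add_sub_cancel_left]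
  rfl

section Count

variable [Finite F] [FiniteDimensional F K]

theorem NonBase.card_fixedBy_one [DecidableEq Fˣ] (c : Fˣ) :
    Nat.card (MulAction.fixedBy (NonBase F K) ((1, c) : (K ≃ₐ[F] K) × Fˣ)) =
      if c = 1 then Nat.card K - Nat.card F else 0 := by
  have := Module.finite_of_finite F (M := K)
  split_ifs with hc
  · subst hc
    rw [← NonBase.card]
    exact Nat.card_congr (Equiv.subtypeUnivEquiv fun a => NonBase.mem_fixedBy.2 (one_smul F a.1))
  · rw [Nat.card_eq_zero]
    refine Or.inl ⟨fun ⟨a, ha⟩ => hc (Units.ext ?_)⟩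
    have h : (c : F) • a.1 = (1 : F) • a.1 := (NonBase.mem_fixedBy.1 ha).trans (one_smul F a.1).symm
    exact smul_left_injective F a.ne_zero h

/-- For `τ` generating the Galois group, `c τ(a) = a` has solutions `a ∉ F` exactly if `c ≠ 1` and
`c^m = 1`; they are the nonzero elements of an eigenspace of `τ`, which has dimension one. -/
theorem NonBase.card_fixedBy [DecidableEq Fˣ] (hp : (Module.finrank F K).Prime) {τ : K ≃ₐ[F] K}
    (hτ : τ ≠ 1) (c : Fˣ) :
    Nat.card (MulAction.fixedBy (NonBase F K) (τ, c)) =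
      if orderOf c = Module.finrank F K then Nat.card F - 1 else 0 := by
  have := Module.finite_of_finite F (M := K)
  have : Fact (Module.finrank F K).Prime := ⟨hp⟩
  have hgen : Subgroup.zpowers τ = ⊤ :=
    zpowers_eq_top_of_prime_card (IsGalois.card_aut_eq_finrank F K) hτ
  have hord := orderOf_eq_finrank hgen
  split_ifs with hc
  · have hc1 : (c : F) ≠ 1 := fun h => by
      rw [Units.val_eq_one.1 h, orderOf_one] at hc
      exact hp.one_lt.ne hc
    obtain ⟨y, hy0, hy⟩ := exists_eigenvector (τ := τ) (c := (c : F)⁻¹) (by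
      rw [hord, ← hc, inv_pow, ← Units.val_pow_eq_pow_val, pow_orderOf_eq_one, Units.val_one,
        inv_one])
    rw [← Algebra.smul_def] at hy
    have hcy : (c : F) • τ y = y := by rw [hy, smul_inv_smul₀ c.ne_zero]
    have hyF (d : Fˣ) : (d : F) • y ∉ Set.range (algebraMap F K) := by
      rintro ⟨e, he⟩
      have h1 : τ ((d : F) • y) = (d : F) • y := by rw [← he, AlgEquiv.commutes]
      rw [map_smul] at h1
      have h2 : τ y = y := by simpa using h1
      rw [h2] at hcy
      exact hc1 (smul_left_injective F hy0 (hcy.trans (one_smul F y).symm))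
    rw [← Nat.card_units]
    refine (Nat.card_congr (Equiv.ofBijective (fun d : Fˣ => (⟨⟨(d : F) • y, hyF d⟩,
      NonBase.mem_fixedBy.2 ?_⟩ : MulAction.fixedBy (NonBase F K) (τ, c))) ⟨?_, ?_⟩)).symm
    · rw [map_smul, smul_comm, hcy]
    · intro d d' h
      have h1 : (d : F) • y = (d' : F) • y := congrArg (fun z => z.1.1) h
      exact Units.ext (smul_left_injective F hy0 h1)
    · rintro ⟨a, ha⟩
      have ha := NonBase.mem_fixedBy.1 ha
      obtain ⟨e, he⟩ := mem_range_algebraMap_of_fixed hgen (x := a.1 / y) (by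
        rw [map_div₀]
        conv_rhs => rw [← ha, ← hcy]
        rw [Algebra.smul_def, Algebra.smul_def, mul_div_mul_left]
        simp)
      have hea : e • y = a.1 := by rw [Algebra.smul_def, he, div_mul_cancel₀ _ hy0]
      have he0 : e ≠ 0 := fun h => a.ne_zero (by rw [← hea, h, zero_smul])
      exact ⟨Units.mk0 e he0, Subtype.ext (Subtype.ext hea)⟩
  · rw [Nat.card_eq_zero]
    refine Or.inl ⟨fun ⟨a, ha⟩ => hc ?_⟩
    have ha := NonBase.mem_fixedBy.1 ha
    have hpow (i : ℕ) : (c : F) ^ i • (τ ^ i) a.1 = a.1 := by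
      induction i with
      | zero => simp
      | succ i ih =>
        rw [pow_succ', pow_succ', AlgEquiv.mul_apply, mul_smul, ← map_smul, ih, ha]
    refine orderOf_eq_prime (Units.ext ?_) fun h1 => ?_
    · have h := hpow (Module.finrank F K)
      rw [← hord, pow_orderOf_eq_one, hord] at h
      exact smul_left_injective F a.ne_zero (h.trans (one_smul F a.1).symm)
    · rw [h1] at ha
      exact apply_ne_self hgen a.2 ((one_smul F _).symm.trans ha)

/-- Burnside's lemma for the action of `Gal(K/F) × Fˣ` on `K ∖ F`. -/
theorem card_orbits_mul (hp : (Module.finrank F K).Prime) :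
    Nat.card (MulAction.orbitRel.Quotient ((K ≃ₐ[F] K) × Fˣ) (NonBase F K)) *
        (Module.finrank F K * (Nat.card F - 1)) =
      Nat.card K - Nat.card F + (Module.finrank F K - 1) *
        (Nat.card {c : Fˣ // orderOf c = Module.finrank F K} * (Nat.card F - 1)) := by
  classical
  have := Module.finite_of_finite F (M := K)
  have : Finite (NonBase F K) := Subtype.finite
  have : Fintype (K ≃ₐ[F] K) := Fintype.ofFinite _
  have : Fintype Fˣ := Fintype.ofFinite _
  have (g : (K ≃ₐ[F] K) × Fˣ) : Fintype (MulAction.fixedBy (NonBase F K) g) := Fintype.ofFinite _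
  have : Fintype (Quotient (MulAction.orbitRel ((K ≃ₐ[F] K) × Fˣ) (NonBase F K))) :=
    Fintype.ofFinite _
  have h := MulAction.sum_card_fixedBy_eq_card_orbits_mul_card_group ((K ≃ₐ[F] K) × Fˣ)
    (NonBase F K)
  simp only [← Nat.card_eq_fintype_card] at h
  rw [Nat.card_prod, IsGalois.card_aut_eq_finrank, Nat.card_units, Fintype.sum_prod_type] at h
  refine h.symm.trans ?_
  rw [← Finset.add_sum_erase _ _ (Finset.mem_univ (1 : K ≃ₐ[F] K))]
  congr 1
  · simp only [NonBase.card_fixedBy_one, Finset.sum_ite_eq', Finset.mem_univ, if_true]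
  · have h2 (τ : K ≃ₐ[F] K) (hτ : τ ∈ Finset.univ.erase 1) :
        ∑ c : Fˣ, Nat.card (MulAction.fixedBy (NonBase F K) (τ, c)) =
          Nat.card {c : Fˣ // orderOf c = Module.finrank F K} * (Nat.card F - 1) := by
      simp only [NonBase.card_fixedBy hp (Finset.ne_of_mem_erase hτ)]
      rw [← Finset.sum_filter, Finset.sum_const, smul_eq_mul,
        Nat.card_eq_fintype_card (α := {c : Fˣ // _}), Fintype.card_subtype]
    rw [Finset.sum_congr rfl h2, Finset.sum_const, smul_eq_mul,
      Finset.card_erase_of_mem (Finset.mem_univ _), Finset.card_univ, ← Nat.card_eq_fintype_card,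
      IsGalois.card_aut_eq_finrank]

/-- For `m = [K:F]` prime, the Sandler semifields of order `q^(m^2)` with center `F` and nuclei `K`
are classified by a generator of `Gal(K/F)` and an orbit of `Gal(K/F) × Fˣ` on `K ∖ F`. -/
theorem card_sandlerClasses (hp : (Module.finrank F K).Prime) :
    Nat.card (SandlerClasses F K (Nat.card F ^ Module.finrank F K ^ 2)) =
      (Module.finrank F K - 1) *
        Nat.card (MulAction.orbitRel.Quotient ((K ≃ₐ[F] K) × Fˣ) (NonBase F K)) := by
  have := Module.finite_of_finite F (M := K)
  rw [← Nat.totient_prime hp, ← card_generators_eq_totient, ← Nat.card_prod]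
  have hiff (σ σ' : {σ : K ≃ₐ[F] K // Subgroup.zpowers σ = ⊤}) (a a' : NonBase F K) :
      Iso F (sandlerSemifield hp σ.2 a.2).carrier (sandlerSemifield hp σ'.2 a'.2).carrier ↔
        σ = σ' ∧ MulAction.orbitRel ((K ≃ₐ[F] K) × Fˣ) (NonBase F K) a a' := by
    have h1 : Iso F (sandlerSemifield hp σ.2 a.2).carrier (sandlerSemifield hp σ'.2 a'.2).carrier ↔
        Iso F (CyclicAlgebra σ.1 a.1) (CyclicAlgebra σ'.1 a'.1) := ⟨Iso.of_op, Iso.op⟩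
    rw [h1, iso_cyclicAlgebra_iff hp.one_lt σ.2 σ'.2 a.2 a'.2, MulAction.orbitRel_apply,
      Subtype.ext_iff]
    refine and_congr_right fun _ => ⟨fun ⟨τ, c, h⟩ => ⟨(τ, c), Subtype.ext h⟩, ?_⟩
    rintro ⟨g, hg⟩
    exact ⟨g.1, g.2, congrArg Subtype.val hg⟩
  symm
  refine Nat.card_congr (Equiv.ofBijective (fun p => Quotient.lift
    (fun a : NonBase F K => (Quotient.mk _ (sandlerSemifield hp p.1.2 a.2) :
      SandlerClasses F K (Nat.card F ^ Module.finrank F K ^ 2)))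
    (fun a a' h => Quotient.sound ((hiff p.1 p.1 a a').2 ⟨rfl, h⟩)) p.2) ⟨?_, ?_⟩)
  · rintro ⟨σ, x⟩ ⟨σ', x'⟩ h
    induction x using Quotient.inductionOn with | _ a
    induction x' using Quotient.inductionOn with | _ a'
    obtain ⟨rfl, h'⟩ := (hiff σ σ' a a').1 (Quotient.exact h)
    exact Prod.ext rfl (Quotient.sound h')
  · intro y
    induction y using Quotient.inductionOn with | _ S
    obtain ⟨σ, a, hσ, ha, h⟩ := S.exists_iso hp.one_lt
    exact ⟨(⟨σ, hσ⟩, Quotient.mk _ ⟨a, ha⟩), Quotient.sound h.symm⟩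

end Count

end Petit

end

theorem mainTheorem3 {F K : Type u} [Field F] [Finite F] [Field K] [Algebra F K] (q m : ℕ)
    (hq : Nat.card F = q) (hm : Module.finrank F K = m) (hm1 : 1 < m) :
    (Nat.card {σ : K ≃ₐ[F] K // Subgroup.zpowers σ = ⊤} = Nat.totient m ∧
      (∀ σ : K ≃ₐ[F] K, Subgroup.zpowers σ = ⊤ →
        ∃ a : K, Petit.IsSemifield F (Petit.CyclicAlgebra σ a)) ∧
      (∀ (σ₁ σ₂ : K ≃ₐ[F] K) (a₁ a₂ : K), Subgroup.zpowers σ₁ = ⊤ → Subgroup.zpowers σ₂ = ⊤ →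
        σ₁ ≠ σ₂ → Petit.IsSemifield F (Petit.CyclicAlgebra σ₁ a₁) →
        Petit.IsSemifield F (Petit.CyclicAlgebra σ₂ a₂) →
        ¬ Petit.Iso F (Petit.CyclicAlgebra σ₁ a₁) (Petit.CyclicAlgebra σ₂ a₂))) ∧
    (m.Prime → ¬ m ∣ q - 1 →
      (Nat.card (Petit.SandlerClasses F K (q ^ (m ^ 2))) : ℚ) =
        ((m : ℚ) - 1) * ((q : ℚ) ^ m - q) / (m * (q - 1))) ∧
    (m.Prime → m ∣ q - 1 →
      (Nat.card (Petit.SandlerClasses F K (q ^ (m ^ 2))) : ℚ) =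
        ((m : ℚ) - 1) * ((m - 1) +
          ((q : ℚ) ^ m - q - (q - 1) * (m - 1)) / (m * (q - 1)))) := by
  subst hq hm
  have : FiniteDimensional F K := Module.finite_of_finrank_pos (by omega)
  have : Finite K := Module.finite_of_finite F
  have hq1 : 1 < Nat.card F := Finite.one_lt_card
  have hqm : Nat.card F ≤ Nat.card F ^ Module.finrank F K := Nat.le_self_pow (by omega) _
  -- Burnside's lemma over the rationals
  have hcount (hp : (Module.finrank F K).Prime) :
      (Nat.card (MulAction.orbitRel.Quotient ((K ≃ₐ[F] K) × Fˣ) (Petit.NonBase F K)) : ℚ) *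
          (Module.finrank F K * (Nat.card F - 1)) =
        (Nat.card F : ℚ) ^ Module.finrank F K - Nat.card F + (Module.finrank F K - 1) *
          (Nat.card {c : Fˣ // orderOf c = Module.finrank F K} * (Nat.card F - 1)) := by
    have h := congrArg (Nat.cast (R := ℚ)) (Petit.card_orbits_mul (F := F) (K := K) hp)
    rw [Module.natCard_eq_pow_finrank (K := F) (V := K)] at h
    push_cast [Nat.cast_sub hqm, Nat.cast_sub hq1.le, Nat.cast_sub hm1.le] at h
    exact h
  have hm0 : (Module.finrank F K : ℚ) ≠ 0 := by positivity
  have hq0 : (Nat.card F : ℚ) - 1 ≠ 0 := sub_ne_zero.2 (by exact_mod_cast hq1.ne')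
  refine ⟨⟨Petit.card_generators_eq_totient, fun σ hσ => Petit.exists_isSemifield hm1 hσ,
    fun σ₁ σ₂ a₁ a₂ h₁ h₂ hne hs₁ hs₂ h => hne ?_⟩, fun hp hndvd => ?_, fun hp hdvd => ?_⟩
  · exact ((Petit.iso_cyclicAlgebra_iff hm1 h₁ h₂ (Petit.notMem_range_of_isDivision hm1 h₁ hs₁.2.2)
      (Petit.notMem_range_of_isDivision hm1 h₂ hs₂.2.2)).1 h).1
  · have h0 : Nat.card {c : Fˣ // orderOf c = Module.finrank F K} = 0 := by
      rw [Nat.card_eq_zero]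
      refine Or.inl ⟨fun ⟨c, hc⟩ => hndvd ?_⟩
      rw [← hc, ← Nat.card_units]
      exact orderOf_dvd_natCard c
    have h := hcount hp
    rw [h0, Nat.cast_zero, zero_mul, mul_zero, add_zero] at h
    rw [Petit.card_sandlerClasses hp, Nat.cast_mul, Nat.cast_sub hm1.le, Nat.cast_one, ← h]
    field_simp
  · have h0 : Nat.card {c : Fˣ // orderOf c = Module.finrank F K} = Module.finrank F K - 1 := by
      classical
      have : Fintype Fˣ := Fintype.ofFinite _
      rw [← Nat.totient_prime hp, Nat.card_eq_fintype_card, Fintype.card_subtype]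
      refine IsCyclic.card_orderOf_eq_totient ?_
      rwa [← Nat.card_eq_fintype_card, Nat.card_units]
    have h := hcount hp
    rw [h0, Nat.cast_sub hm1.le, Nat.cast_one] at h
    rw [Petit.card_sandlerClasses hp, Nat.cast_mul, Nat.cast_sub hm1.le, Nat.cast_one]
    congr 1
    field_simp
    linear_combination h
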